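/- Let $n\ge 1$. (i) Let $K=\mathrm{conv}(0,e_1,\dots,e_n)\subset\mathbb{R}^n$, where $e_1,\dots,e_n$ are the standard unit vectors. Then for every Lipschitz function $f:K\to\mathbb{R}$ with $\int_K f(x)\,dx=0$, $$\int_K f(x)^2\,dx\;\le\;\frac1{n+1}\int_K\Big[\sum_{i=1}^n x_i\,|\partial_i f(x)|^2-\Big(\sum_{i=1}^n x_i\,\partial_i f(x)\Big)^2\Big]dx .$$ (ii) Equivalently, let $\Delta^n=\{(x_0,\dots,x_n)\in\mathbb{R}^{n+1}: x_i>0 \text{ for all } i,\ \sum_{i=0}^n x_i=1\}$, let $dx$ denote the $n$-dimensional volume measure on $\Delta^n$, and for $0\le i,j\le n$ let $E^{ij}f=\big(\frac{\partial}{\partial x_i}-\frac{\partial}{\partial x_j}\big)f$ be the derivative of $f$ in the direction $e_i-e_j$, which is tangent to $\Delta^n$. Then for every Lipschitz function $f:\Delta^n\to\mathbb{R}$ with $\int_{\Delta^n} f(x)\,dx=0$, $$\int_{\Delta^n} f(x)^2\,dx\;\le\;\frac1{n+1}\int_{\Delta^n}\sum_{0\le i<j\le n} x_i x_j\,|E^{ij}f(x)|^2\,dx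 .$$ (The derivatives of a Lipschitz function exist almost everywhere.) -/

import Mathlib

open MeasureTheory

/-- The simplex `K = conv(0, e₁, …, eₙ)` in `ℝⁿ`. -/
def solidSimplex (n : ℕ) : Set (EuclideanSpace ℝ (Fin n)) :=
  convexHull ℝ (insert 0 (Set.range fun i : Fin n => EuclideanSpace.single i (1 : ℝ)))

/-- The (relatively open) regular simplex `Δⁿ` of all `x ∈ ℝⁿ⁺¹` with positive coordinates
`x₀, …, xₙ` whose sum is `1`. -/
def regularSimplex (n : ℕ) : Set (EuclideanSpace ℝ (Fin (n + 1))) :=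
  {x | (∀ i, 0 < x i) ∧ ∑ i, x i = 1}

/-- The partial derivative `∂f/∂xᵢ`, as the derivative of `f` along the line in direction `eᵢ`. -/
noncomputable def partialDeriv {n : ℕ} (i : Fin n) (f : EuclideanSpace ℝ (Fin n) → ℝ)
    (x : EuclideanSpace ℝ (Fin n)) : ℝ :=
  lineDeriv ℝ f x (EuclideanSpace.single i (1 : ℝ))

/-- `Eⁱʲ f = (∂/∂xᵢ - ∂/∂xⱼ) f`, the derivative of `f` in the direction `eᵢ - eⱼ`. This direction
is tangent to `Δⁿ`, so at a point of `Δⁿ` the value depends only on the restriction of `f` to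
`Δⁿ`. -/
noncomputable def tangentDeriv {n : ℕ} (i j : Fin (n + 1))
    (f : EuclideanSpace ℝ (Fin (n + 1)) → ℝ) (p : EuclideanSpace ℝ (Fin (n + 1))) : ℝ :=
  lineDeriv ℝ f p (EuclideanSpace.single i (1 : ℝ) - EuclideanSpace.single j (1 : ℝ))

/-! Let `Y₀, …, Yₙ` be independent exponential variables of rate one and let `S` be their sum. Then
`S` has a gamma law and is independent of the proportions `Yᵢ / S`, which are uniform on the
simplex. A function `g` on the simplex extends to the orthant as the degree-one function `F(y) = S
g(y / S)` (`coneExt`), and a weighted Poincaré inequality for `F` under the exponential law descends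
to one for `g`.

In one variable the inequality is `Var g ≤ E[t g'(t)²]` (`poincare_expDist`). It tensorizes to `Var
F ≤ E ∑ yᵢ (∂ᵢF)²` (`poincare_expPi`), because variance on a product is at most the sum of the
averaged partial variances.

Write `Γ(g)` for the integrand on the right of (i). Integrating out `S`
(`integral_expPi_of_homogeneous`) turns `E F` into `(n+1)! ∫ g = 0`, `E F²` into `(n+2)! ∫ g²`, and
the energy into `(n+1)! ∫ (g² + Γ(g))`. Hence `(n+2) ∫ g² ≤ ∫ g² + ∫ Γ(g)`, which gives the constant
`1/(n+1)`.

For (ii), Lagrange's identity turns the pairwise sum into `Γ(g)` in the affine chart, where the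
surface measure is a constant multiple of Lebesgue measure. -/

namespace SimplexPoincare

open Set Filter Topology

/-! ### One variable: the weighted Poincaré inequality for the exponential law. -/

/-- The exponential distribution with rate one. -/
noncomputable def expDist : Measure ℝ :=
  (volume.restrict (Ioi 0)).withDensity fun t => ENNReal.ofReal (Real.exp (-t))

theorem lintegral_expDist {h : ℝ → ENNReal} (hh : Measurable h) :
    ∫⁻ t, h t ∂expDist = ∫⁻ t in Ioi 0, ENNReal.ofReal (Real.exp (-t)) * h t := by
  rw [expDist, lintegral_withDensity_eq_lintegral_mul _ (by fun_prop) hh]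
  rfl

theorem integrableOn_exp_neg_mul_pow (k : ℕ) :
    IntegrableOn (fun t : ℝ => Real.exp (-t) * t ^ k) (Ioi 0) := by
  have := Real.GammaIntegral_convergent (s := (k : ℝ) + 1) (by positivity)
  refine this.congr_fun (fun t ht => ?_) measurableSet_Ioi
  simp

instance : IsProbabilityMeasure expDist where
  measure_univ := by
    rw [expDist, withDensity_apply _ MeasurableSet.univ, Measure.restrict_univ,
      ← ofReal_integral_eq_lintegral_ofReal, integral_exp_neg_Ioi_zero, ENNReal.ofReal_one]
    · have := integrableOn_exp_neg_mul_pow 0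
      simpa [IntegrableOn] using this
    · exact ae_of_all _ fun t => (Real.exp_pos _).le

theorem expDist_ae_pos : ∀ᵐ t ∂expDist, 0 < t :=
  (withDensity_absolutelyContinuous _ _).ae_le (ae_restrict_mem measurableSet_Ioi)

theorem integrable_pow_expDist (k : ℕ) : Integrable (fun t : ℝ => t ^ k) expDist := by
  rw [expDist, integrable_withDensity_iff (by fun_prop) (by simp)]
  refine (integrableOn_exp_neg_mul_pow k).congr_fun (fun t ht => ?_) measurableSet_Ioi
  simp [ENNReal.toReal_ofReal, Real.exp_nonneg, mul_comm]

theorem memLp_id_expDist : MemLp (fun t : ℝ => t) 2 expDist := by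
  rw [memLp_two_iff_integrable_sq (by fun_prop)]
  exact integrable_pow_expDist 2

/-- Cauchy–Schwarz applied to the integral of `deriv g`; a Lipschitz function is absolutely
continuous, so that integral recovers the increment. -/
theorem sq_sub_le_mul_lintegral_deriv {g : ℝ → ℝ} {L : NNReal} (hg : LipschitzWith L g)
    (a b : ℝ) :
    ENNReal.ofReal ((g b - g a) ^ 2) ≤
      ENNReal.ofReal |b - a| * ∫⁻ u in uIoc a b, ENNReal.ofReal (deriv g u ^ 2) := by
  have hac : AbsolutelyContinuousOnInterval g a b :=
    (hg.lipschitzOnWith (s := uIcc a b)).absolutelyContinuousOnInterval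
  have hbd : ∀ u, |deriv g u| ≤ L := fun u => norm_deriv_le_of_lipschitz hg
  have hfin : IsFiniteMeasure (volume.restrict (uIoc a b)) := by
    rw [uIoc]; infer_instance
  have hm : MemLp (deriv g) 2 (volume.restrict (uIoc a b)) :=
    MemLp.of_bound (measurable_deriv g).aestronglyMeasurable L (ae_of_all _ hbd)
  have hi : Integrable (fun u => deriv g u ^ 2) (volume.restrict (uIoc a b)) := hm.integrable_sq
  rw [← ofReal_integral_eq_lintegral_ofReal hi (ae_of_all _ fun u => sq_nonneg _),
    ← ENNReal.ofReal_mul (abs_nonneg _)]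
  apply ENNReal.ofReal_le_ofReal
  have hv : (volume.restrict (uIoc a b)).real univ = |b - a| := by
    simp [Measure.real, uIoc, Real.volume_Ioc, max_sub_min_eq_abs]
  have h1 : |g b - g a| = |∫ u in uIoc a b, deriv g u| := by
    rw [← hac.integral_deriv_eq_sub, intervalIntegral.abs_intervalIntegral_eq]
  rw [← sq_abs, h1, sq_abs, ← hv]
  set ν := volume.restrict (uIoc a b)
  set m := ∫ u, deriv g u ∂ν
  have hint : Integrable (deriv g) ν := hm.integrable (by norm_num)
  -- Cauchy–Schwarz from a nonnegative square; dividing by the total mass later requires treating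
  -- mass zero apart.
  have key : 0 ≤ ∫ u, (ν.real univ * deriv g u - m) ^ 2 ∂ν := integral_nonneg fun u => sq_nonneg _
  have e1 : ∫ u, (ν.real univ * deriv g u - m) ^ 2 ∂ν =
      ν.real univ * (ν.real univ * (∫ u, deriv g u ^ 2 ∂ν) - m ^ 2) := by
    have : (fun u => (ν.real univ * deriv g u - m) ^ 2) = fun u =>
        (ν.real univ ^ 2 * deriv g u ^ 2 - 2 * ν.real univ * m * deriv g u) + m ^ 2 := by
      ext u; ring
    rw [this, integral_add (f := fun u => ν.real univ ^ 2 * deriv g u ^ 2 -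
        2 * ν.real univ * m * deriv g u) ((hi.const_mul _).sub (hint.const_mul _))
        (integrable_const _), integral_sub (hi.const_mul _) (hint.const_mul _), integral_const_mul, integral_const_mul,
      integral_const, smul_eq_mul]
    change _ - _ * m + _ = _
    ring
  rw [e1] at key
  rcases (measureReal_nonneg (μ := ν) (s := univ)).eq_or_lt' with h0 | h0
  · have hν : ν = 0 := by
      rw [measureReal_eq_zero_iff] at h0
      simpa using h0
    simp [m, hν]
  · nlinarith [nonneg_of_mul_nonneg_right key h0]

/-- The primitive is `-t e⁻ᵗ`. Because `1` is the mean of the law, this upper tail and the lower one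
in `lintegral_Ioc_one_sub_mul_exp` have the same form `u e⁻ᵘ`, which is where the weight `t` in the
Poincaré inequality comes from. -/
theorem lintegral_Ioi_sub_one_mul_exp {u : ℝ} (hu : 1 ≤ u) :
    ∫⁻ t in Ioi u, ENNReal.ofReal (Real.exp (-t) * |t - 1|) = ENNReal.ofReal (u * Real.exp (-u)) := by
  have hd : ∀ t ∈ Ici u, HasDerivAt (fun t => -(t * Real.exp (-t))) (Real.exp (-t) * |t - 1|) t := by
    intro t ht
    have h := ((hasDerivAt_id t).mul (hasDerivAt_neg t).exp).neg
    convert! h using 1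
    have : 0 ≤ t - 1 := by linarith [mem_Ici.1 ht]
    rw [abs_of_nonneg this]; simp; ring
  have hlim : Tendsto (fun t : ℝ => -(t * Real.exp (-t))) atTop (𝓝 0) := by
    simpa using (Real.tendsto_pow_mul_exp_neg_atTop_nhds_zero 1).neg
  have hpos : ∀ t ∈ Ioi u, 0 ≤ Real.exp (-t) * |t - 1| := fun t _ => by positivity
  rw [← ofReal_integral_eq_lintegral_ofReal
    (integrableOn_Ioi_deriv_of_nonneg' hd hpos hlim) (ae_of_all _ fun t => by positivity),
    integral_Ioi_of_hasDerivAt_of_nonneg' hd hpos hlim]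
  simp

theorem lintegral_Ioc_one_sub_mul_exp {u : ℝ} (hu0 : 0 < u) (hu : u ≤ 1) :
    ∫⁻ t in Ioc 0 u, ENNReal.ofReal (Real.exp (-t) * |t - 1|) = ENNReal.ofReal (u * Real.exp (-u)) := by
  have hd : ∀ t ∈ uIcc 0 u, HasDerivAt (fun t => t * Real.exp (-t)) (Real.exp (-t) * |t - 1|) t := by
    intro t ht
    have h := ((hasDerivAt_id t).mul (hasDerivAt_neg t).exp)
    convert! h using 1
    rw [uIcc_of_le hu0.le] at ht
    have : t - 1 ≤ 0 := by linarith [ht.2]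
    rw [abs_of_nonpos this]; simp; ring
  have hc : Continuous fun t : ℝ => Real.exp (-t) * |t - 1| := by fun_prop
  rw [← ofReal_integral_eq_lintegral_ofReal (hc.integrableOn_Ioc) (ae_of_all _ fun t => by positivity),
    ← intervalIntegral.integral_of_le hu0.le,
    intervalIntegral.integral_eq_sub_of_hasDerivAt hd (hc.intervalIntegrable _ _)]
  simp

/-- Bound `(g t - g 1)²` by `|t - 1|` times the integral of `g'²` between `1` and `t`, then apply
Tonelli: the factor in front of `g'(u)²` is a tail integral of `|t - 1| e⁻ᵗ`, equal to `u e⁻ᵘ`. -/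
theorem lintegral_expDist_sq_sub_le {g : ℝ → ℝ} {L : NNReal} (hg : LipschitzWith L g) :
    ∫⁻ t, ENNReal.ofReal ((g t - g 1) ^ 2) ∂expDist ≤
      ∫⁻ t, ENNReal.ofReal (t * deriv g t ^ 2) ∂expDist := by
  have hgm : Measurable g := hg.continuous.measurable
  have hdm : Measurable (deriv g) := measurable_deriv g
  rw [lintegral_expDist (by fun_prop), lintegral_expDist (by fun_prop)]
  let k : ℝ → ℝ → ENNReal := fun t u => (uIoc 1 t).indicator
    (fun u => ENNReal.ofReal (Real.exp (-t) * |t - 1|) * ENNReal.ofReal (deriv g u ^ 2)) u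
  have hset : MeasurableSet {p : ℝ × ℝ | p.2 ∈ uIoc 1 p.1} := by
    have : {p : ℝ × ℝ | p.2 ∈ uIoc 1 p.1} =
        {p : ℝ × ℝ | min 1 p.1 < p.2} ∩ {p : ℝ × ℝ | p.2 ≤ max 1 p.1} := rfl
    rw [this]
    exact (measurableSet_lt (by fun_prop) (by fun_prop)).inter
      (measurableSet_le (by fun_prop) (by fun_prop))
  have hk : Measurable (Function.uncurry k) := by
    have : Function.uncurry k = {p : ℝ × ℝ | p.2 ∈ uIoc 1 p.1}.indicator (fun p =>
      ENNReal.ofReal (Real.exp (-p.1) * |p.1 - 1|) * ENNReal.ofReal (deriv g p.2 ^ 2)) := by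
      ext p; rfl
    rw [this]
    have h2 : Measurable fun p : ℝ × ℝ => deriv g p.2 := hdm.comp measurable_snd
    exact Measurable.indicator (by fun_prop) hset
  calc ∫⁻ t in Ioi 0, ENNReal.ofReal (Real.exp (-t)) * ENNReal.ofReal ((g t - g 1) ^ 2)
      ≤ ∫⁻ t in Ioi 0, ∫⁻ u, k t u := by
        refine lintegral_mono fun t => ?_
        simp only [k]
        rw [lintegral_indicator measurableSet_uIoc, lintegral_const_mul _ (by fun_prop),
          ENNReal.ofReal_mul (Real.exp_nonneg _), mul_assoc]
        gcongr
        exact sq_sub_le_mul_lintegral_deriv hg 1 t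
    _ = ∫⁻ u, ∫⁻ t in Ioi 0, k t u := lintegral_lintegral_swap hk.aemeasurable
    _ ≤ ∫⁻ u, (Ioi 0).indicator (fun u =>
          ENNReal.ofReal (Real.exp (-u)) * ENNReal.ofReal (u * deriv g u ^ 2)) u := by
        refine lintegral_mono fun u => ?_
        have hw : Measurable fun t : ℝ => ENNReal.ofReal (Real.exp (-t) * |t - 1|) := by fun_prop
        rcases le_or_gt u 0 with hu | hu
        · have : ∫⁻ t in Ioi 0, k t u = 0 := by
            rw [setLIntegral_congr_fun (g := 0) measurableSet_Ioi]
            · simp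
            · intro t ht
              have : u ∉ uIoc 1 t := fun h => by
                have := h.1
                rcases min_lt_iff.1 this with h | h <;> linarith [mem_Ioi.1 ht]
              simp [k, this]
          simp [this]
        have hrhs : (Ioi 0).indicator (fun u =>
            ENNReal.ofReal (Real.exp (-u)) * ENNReal.ofReal (u * deriv g u ^ 2)) u =
            ENNReal.ofReal (u * Real.exp (-u)) * ENNReal.ofReal (deriv g u ^ 2) := by
          rw [indicator_of_mem (mem_Ioi.2 hu), ← ENNReal.ofReal_mul (Real.exp_nonneg _),
            ← ENNReal.ofReal_mul (by positivity)]
          ring_nf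
        rw [hrhs]
        rcases le_or_gt u 1 with hu1 | hu1
        · rw [← lintegral_Ioc_one_sub_mul_exp hu hu1, ← lintegral_mul_const _ hw,
            ← lintegral_indicator measurableSet_Ioc, ← lintegral_indicator measurableSet_Ioi]
          refine lintegral_mono fun t => ?_
          by_cases ht : 0 < t
          · rw [indicator_of_mem (mem_Ioi.2 ht)]
            by_cases hut : u ∈ uIoc 1 t
            · have : t ≤ u := by
                rcases min_lt_iff.1 hut.1 with h | h <;> linarith
              rw [indicator_of_mem (mem_Ioc.2 ⟨ht, this⟩)]
              simp [k, hut]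
            · simp [k, hut]
          · simp [ht]
        -- For `u > 1` the condition `u ∈ uIoc 1 t` includes `t = u`, so the tail is first closed up
        -- to `Ici u`.
        · rw [← lintegral_Ioi_sub_one_mul_exp hu1.le, setLIntegral_congr (Ioi_ae_eq_Ici (a := u)),
            ← lintegral_mul_const _ hw,
            ← lintegral_indicator measurableSet_Ici, ← lintegral_indicator measurableSet_Ioi]
          refine lintegral_mono fun t => ?_
          by_cases ht : 0 < t
          · rw [indicator_of_mem (mem_Ioi.2 ht)]
            by_cases hut : u ∈ uIoc 1 t
            · have : u ≤ t := by
                rcases le_max_iff.1 hut.2 with h | h <;> linarith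
              rw [indicator_of_mem (mem_Ici.2 this)]
              simp [k, hut]
            · simp [k, hut]
          · simp [ht]
    _ = _ := lintegral_indicator measurableSet_Ioi _

theorem memLp_lipschitz_expDist {g : ℝ → ℝ} {L : NNReal} (hg : LipschitzWith L g) :
    MemLp g 2 expDist := by
  refine MemLp.of_le ((memLp_id_expDist.norm.const_mul L).add (memLp_const |g 0|))
    hg.continuous.aestronglyMeasurable (ae_of_all _ fun t => ?_)
  have h := hg.dist_le_mul t 0
  rw [Real.dist_eq, Real.dist_eq, sub_zero] at h
  have h2 := abs_sub_abs_le_abs_sub (g t) (g 0)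
  refine le_trans ?_ (le_abs_self _)
  simp only [Real.norm_eq_abs, Pi.add_apply]
  linarith

theorem integrable_mul_deriv_sq_expDist {g : ℝ → ℝ} {L : NNReal} (hg : LipschitzWith L g) :
    Integrable (fun t => t * deriv g t ^ 2) expDist := by
  have hdm : Measurable (deriv g) := measurable_deriv g
  refine Integrable.mul_bdd (c := (L : ℝ) ^ 2) (by simpa using integrable_pow_expDist 1)
    (by fun_prop) (ae_of_all _ fun t => ?_)
  have : |deriv g t| ≤ L := norm_deriv_le_of_lipschitz hg
  rw [Real.norm_eq_abs, abs_pow]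
  gcongr

/-- The weighted Poincaré inequality for the exponential distribution. -/
theorem poincare_expDist {g : ℝ → ℝ} {L : NNReal} (hg : LipschitzWith L g) :
    ∫ t, g t ^ 2 ∂expDist - (∫ t, g t ∂expDist) ^ 2 ≤ ∫ t, t * deriv g t ^ 2 ∂expDist := by
  have hL := memLp_lipschitz_expDist hg
  have hi := hL.integrable (by norm_num)
  have hsub : Integrable (fun t => (g t - g 1) ^ 2) expDist :=
    (hL.sub (memLp_const (g 1))).integrable_sq
  have hexp : ∫ t, (g t - g 1) ^ 2 ∂expDist =
      ∫ t, g t ^ 2 ∂expDist - 2 * g 1 * ∫ t, g t ∂expDist + g 1 ^ 2 := by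
    have : (fun t => (g t - g 1) ^ 2) = fun t => (g t ^ 2 - 2 * g 1 * g t) + g 1 ^ 2 := by
      ext t; ring
    rw [this, integral_add (f := fun t => g t ^ 2 - 2 * g 1 * g t)
      (hL.integrable_sq.sub (hi.const_mul _)) (integrable_const _),
      integral_sub hL.integrable_sq (hi.const_mul _), integral_const_mul]
    simp
  have hle : ∫ t, (g t - g 1) ^ 2 ∂expDist ≤ ∫ t, t * deriv g t ^ 2 ∂expDist := by
    have hpos : 0 ≤ᵐ[expDist] fun t => t * deriv g t ^ 2 := by
      filter_upwards [expDist_ae_pos] with t ht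
      exact mul_nonneg ht.le (sq_nonneg _)
    have h := lintegral_expDist_sq_sub_le hg
    rw [← ofReal_integral_eq_lintegral_ofReal hsub (ae_of_all _ fun t => sq_nonneg _),
      ← ofReal_integral_eq_lintegral_ofReal (integrable_mul_deriv_sq_expDist hg) hpos] at h
    exact (ENNReal.ofReal_le_ofReal_iff (integral_nonneg_of_ae hpos)).1 h
  -- The second moment about `g 1` is the variance plus `(E g - g 1)²`.
  nlinarith [sq_nonneg (∫ t, g t ∂expDist - g 1)]

/-! ### Several variables: tensorization to independent exponentials. -/

/-- The joint distribution of `n` independent exponential variables with rate one. -/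
noncomputable def expPi (n : ℕ) : Measure (Fin n → ℝ) := Measure.pi fun _ => expDist

instance (n : ℕ) : IsProbabilityMeasure (expPi n) := by
  unfold expPi; infer_instance

theorem measurePreserving_cons (n : ℕ) (μ : Measure ℝ) [SigmaFinite μ] :
    MeasurePreserving (fun p : ℝ × (Fin n → ℝ) => (Fin.cons p.1 p.2 : Fin (n + 1) → ℝ))
      (μ.prod (Measure.pi fun _ => μ)) (Measure.pi fun _ => μ) := by
  have h := (measurePreserving_piFinSuccAbove (fun _ : Fin (n + 1) => μ) 0).symm
  convert! h using 1
  ext p i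
  refine Fin.cases ?_ (fun i => ?_) i <;> simp [MeasurableEquiv.piFinSuccAbove]

theorem memLp_eval_expPi (n : ℕ) (i : Fin n) : MemLp (fun y : Fin n → ℝ => y i) 2 (expPi n) :=
  memLp_id_expDist.comp_measurePreserving (measurePreserving_eval (fun _ : Fin n => expDist) i)

theorem memLp_lipschitz_expPi {n : ℕ} {f : (Fin n → ℝ) → ℝ} {L : NNReal}
    (hf : LipschitzWith L f) : MemLp f 2 (expPi n) := by
  refine MemLp.of_le (((memLp_finsetSum Finset.univ fun i _ =>
    (memLp_eval_expPi n i).norm).const_mul L).add (memLp_const |f 0|))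
    hf.continuous.aestronglyMeasurable (ae_of_all _ fun y => ?_)
  have h := hf.dist_le_mul y 0
  rw [Real.dist_eq, dist_zero_right] at h
  have h2 := abs_sub_abs_le_abs_sub (f y) (f 0)
  have h3 : ‖y‖ ≤ ∑ i, ‖y i‖ := by
    refine (pi_norm_le_iff_of_nonneg (Finset.sum_nonneg fun i _ => norm_nonneg _)).2 fun i => ?_
    exact Finset.single_le_sum (f := fun i => ‖y i‖) (fun i _ => norm_nonneg _) (Finset.mem_univ i)
  have h4 := mul_le_mul_of_nonneg_left h3 L.coe_nonneg
  refine le_trans ?_ (le_abs_self _)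
  simp only [Real.norm_eq_abs, Pi.add_apply] at *
  linarith

theorem integrable_mul_lineDeriv_sq_expPi {n : ℕ} {f : (Fin n → ℝ) → ℝ} {L : NNReal}
    (hf : LipschitzWith L f) (i : Fin n) (v : Fin n → ℝ) :
    Integrable (fun y => y i * lineDeriv ℝ f y v ^ 2) (expPi n) := by
  have hdm : Measurable fun y => lineDeriv ℝ f y v := measurable_lineDeriv hf.continuous
  refine Integrable.mul_bdd (c := (L * ‖v‖) ^ 2) ((memLp_eval_expPi n i).integrable (by norm_num))
    (by fun_prop) (ae_of_all _ fun t => ?_)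
  have : ‖lineDeriv ℝ f t v‖ ≤ L * ‖v‖ := norm_lineDeriv_le_of_lipschitz ℝ hf
  rw [norm_pow]
  gcongr

/-- The variance of a function on a product is at most the sum of the averages of its partial
variances. -/
theorem integral_prod_variance_le {α β : Type*} [MeasurableSpace α] [MeasurableSpace β]
    {μ : Measure α} {ν : Measure β} [IsProbabilityMeasure μ] [IsProbabilityMeasure ν]
    {G : α × β → ℝ} (hG : MemLp G 2 (μ.prod ν))
    (ha : MemLp (fun y => ∫ x, G (x, y) ∂μ) 2 ν) (hb : MemLp (fun x => ∫ y, G (x, y) ∂ν) 2 μ) :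
    ∫ p, G p ^ 2 ∂μ.prod ν - (∫ p, G p ∂μ.prod ν) ^ 2 ≤
      (∫ p, G p ^ 2 ∂μ.prod ν - ∫ y, (∫ x, G (x, y) ∂μ) ^ 2 ∂ν) +
      (∫ p, G p ^ 2 ∂μ.prod ν - ∫ x, (∫ y, G (x, y) ∂ν) ^ 2 ∂μ) := by
  set a := fun y => ∫ x, G (x, y) ∂μ with ha_def
  set b := fun x => ∫ y, G (x, y) ∂ν with hb_def
  set m := ∫ p, G p ∂μ.prod ν with hm
  have hGi : Integrable G (μ.prod ν) := hG.integrable (by norm_num)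
  have hA : MemLp (fun p : α × β => a p.2) 2 (μ.prod ν) :=
    ha.comp_measurePreserving measurePreserving_snd
  have hB : MemLp (fun p : α × β => b p.1) 2 (μ.prod ν) :=
    hb.comp_measurePreserving measurePreserving_fst
  have iGA : Integrable (fun p => G p * a p.2) (μ.prod ν) := hG.integrable_mul hA
  have iGB : Integrable (fun p => G p * b p.1) (μ.prod ν) := hG.integrable_mul hB
  have iA2 := hA.integrable_sq
  have iB2 := hB.integrable_sq
  have iA := hA.integrable (by norm_num)
  have iB := hB.integrable (by norm_num)
  have iBA : Integrable (fun p => b p.1 * a p.2) (μ.prod ν) := hB.integrable_mul hA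
  have eA2 : ∫ p, a p.2 ^ 2 ∂μ.prod ν = ∫ y, a y ^ 2 ∂ν := by
    simpa using integral_prod_mul (μ := μ) (ν := ν) (fun _ => (1 : ℝ)) (fun y => a y ^ 2)
  have eB2 : ∫ p, b p.1 ^ 2 ∂μ.prod ν = ∫ x, b x ^ 2 ∂μ := by
    simpa using integral_prod_mul (μ := μ) (ν := ν) (fun x => b x ^ 2) (fun _ => (1 : ℝ))
  have ea : ∫ y, a y ∂ν = m := (integral_prod_symm G hGi).symm
  have eb : ∫ x, b x ∂μ = m := (integral_prod G hGi).symm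
  have eA : ∫ p, a p.2 ∂μ.prod ν = m := by
    rw [← ea]
    simpa using integral_prod_mul (μ := μ) (ν := ν) (fun _ => (1 : ℝ)) a
  have eB : ∫ p, b p.1 ∂μ.prod ν = m := by
    rw [← eb]
    simpa using integral_prod_mul (μ := μ) (ν := ν) b (fun _ => (1 : ℝ))
  have eBA : ∫ p, b p.1 * a p.2 ∂μ.prod ν = m * m := by
    rw [integral_prod_mul b a, ea, eb]
  have eGA : ∫ p, G p * a p.2 ∂μ.prod ν = ∫ y, a y ^ 2 ∂ν := by
    rw [integral_prod_symm _ iGA]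
    refine integral_congr_ae (ae_of_all _ fun y => ?_)
    simp only [integral_mul_const]
    rw [sq]
  have eGB : ∫ p, G p * b p.1 ∂μ.prod ν = ∫ x, b x ^ 2 ∂μ := by
    rw [integral_prod _ iGB]
    refine integral_congr_ae (ae_of_all _ fun y => ?_)
    simp only [integral_mul_const]
    rw [sq]
  -- `G - a - b + m` is the interaction part of `G`, orthogonal to functions of one variable; its
  -- squared norm is `∫ G² - ∫ a² - ∫ b² + m²`, and nonnegativity is the claim rearranged.
  have key : 0 ≤ ∫ p, (G p - a p.2 - b p.1 + m) ^ 2 ∂μ.prod ν :=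
    integral_nonneg fun p => sq_nonneg _
  have hexp : (fun p : α × β => (G p - a p.2 - b p.1 + m) ^ 2) =
      (fun p => G p ^ 2) + (fun p => a p.2 ^ 2) + (fun p => b p.1 ^ 2) + (fun _ => m ^ 2)
        - (2 : ℝ) • (fun p => G p * a p.2) - (2 : ℝ) • (fun p => G p * b p.1)
        + (2 : ℝ) • (fun p => b p.1 * a p.2)
        + (2 * m) • G - (2 * m) • (fun p => a p.2) - (2 * m) • (fun p => b p.1) := by
    ext p
    simp only [Pi.add_apply, Pi.sub_apply, Pi.smul_apply, smul_eq_mul]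
    ring
  have i1 := hG.integrable_sq
  have i4 : Integrable (fun _ : α × β => m ^ 2) (μ.prod ν) := integrable_const _
  have j2 := i1.add iA2
  have j3 := j2.add iB2
  have j4 := j3.add i4
  have j5 := j4.sub (iGA.smul (2 : ℝ))
  have j6 := j5.sub (iGB.smul (2 : ℝ))
  have j7 := j6.add (iBA.smul (2 : ℝ))
  have j8 := j7.add (hGi.smul (2 * m))
  have j9 := j8.sub (iA.smul (2 * m))
  rw [hexp, integral_sub' j9 (iB.smul _), integral_sub' j8 (iA.smul _),
    integral_add' j7 (hGi.smul _), integral_add' j6 (iBA.smul _), integral_sub' j5 (iGB.smul _),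
    integral_sub' j4 (iGA.smul _), integral_add' j3 i4, integral_add' j2 iB2,
    integral_add' i1 iA2] at key
  simp only [Pi.smul_apply, smul_eq_mul, integral_const_mul, eA2, eB2, eA, eB, eBA, eGA, eGB, ← hm,
    integral_const, probReal_univ] at key
  simp only [ha_def, hb_def] at key
  linarith

/-- Keeps the partial averages Lipschitz, hence square integrable, as `integral_prod_variance_le`
requires. -/
theorem lipschitzWith_integral {α : Type*} {E : Type*} [MeasurableSpace α]
    [PseudoMetricSpace E] {μ : Measure α} [IsProbabilityMeasure μ] {G : α → E → ℝ} {L : NNReal}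
    (hG : ∀ x, LipschitzWith L (G x)) (hi : ∀ y, Integrable (fun x => G x y) μ) :
    LipschitzWith L fun y => ∫ x, G x y ∂μ := by
  refine LipschitzWith.of_dist_le_mul fun y z => ?_
  rw [dist_eq_norm, ← integral_sub (hi y) (hi z)]
  refine (norm_integral_le_of_norm_le_const (C := L * dist y z) (ae_of_all _ fun x => ?_)).trans ?_
  · rw [← dist_eq_norm]; exact (hG x).dist_le_mul y z
  · simp

theorem lipschitzWith_cons_left {n : ℕ} (y : Fin n → ℝ) :
    LipschitzWith 1 fun t : ℝ => (Fin.cons t y : Fin (n + 1) → ℝ) := by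
  refine LipschitzWith.of_dist_le_mul fun s t => ?_
  rw [NNReal.coe_one, one_mul]
  refine (dist_pi_le_iff dist_nonneg).2 fun i => ?_
  refine Fin.cases ?_ (fun i => ?_) i <;> simp

theorem lipschitzWith_cons_right {n : ℕ} (t : ℝ) :
    LipschitzWith 1 fun y : Fin n → ℝ => (Fin.cons t y : Fin (n + 1) → ℝ) := by
  refine LipschitzWith.of_dist_le_mul fun y z => ?_
  rw [NNReal.coe_one, one_mul]
  refine (dist_pi_le_iff dist_nonneg).2 fun i => ?_
  refine Fin.cases ?_ (fun i => ?_) i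
  · simp
  · simpa using dist_le_pi_dist y z i

theorem lineDeriv_single_zero {n : ℕ} (f : (Fin (n + 1) → ℝ) → ℝ) (t : ℝ) (y : Fin n → ℝ) :
    lineDeriv ℝ f (Fin.cons t y) (Pi.single 0 1) = deriv (fun u => f (Fin.cons u y)) t := by
  have h : ∀ u : ℝ, (Fin.cons t y + u • Pi.single 0 1 : Fin (n + 1) → ℝ) = Fin.cons (t + u) y := by
    intro u
    ext i
    refine Fin.cases ?_ (fun i => ?_) i <;> simp
  rw [lineDeriv]
  simp only [h]
  rw [deriv_comp_const_add (f := fun u => f (Fin.cons u y)) t 0, add_zero]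

theorem lineDeriv_single_succ {n : ℕ} (f : (Fin (n + 1) → ℝ) → ℝ) (t : ℝ) (y : Fin n → ℝ)
    (i : Fin n) :
    lineDeriv ℝ f (Fin.cons t y) (Pi.single i.succ 1) =
      lineDeriv ℝ (fun z => f (Fin.cons t z)) y (Pi.single i 1) := by
  have h : ∀ u : ℝ, (Fin.cons t y + u • Pi.single i.succ 1 : Fin (n + 1) → ℝ) =
      Fin.cons t (y + u • Pi.single i 1) := by
    intro u
    ext j
    refine Fin.cases ?_ (fun j => ?_) j
    · simp
    · simp [Pi.single_apply]
  rw [lineDeriv, lineDeriv]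
  simp only [h]

/-- The weighted Poincaré inequality for independent exponential variables. -/
theorem poincare_expPi (n : ℕ) {f : (Fin n → ℝ) → ℝ} {L : NNReal} (hf : LipschitzWith L f) :
    ∫ y, f y ^ 2 ∂expPi n - (∫ y, f y ∂expPi n) ^ 2 ≤
      ∫ y, ∑ i, y i * lineDeriv ℝ f y (Pi.single i 1) ^ 2 ∂expPi n := by
  induction n with
  | zero =>
    have : expPi 0 = Measure.dirac 0 := by
      rw [expPi, Measure.pi_of_empty (fun _ : Fin 0 => expDist) 0]
    rw [this]
    simp
  | succ n ih =>
    have hcons := measurePreserving_cons n expDist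
    have hcm : Measurable fun p : ℝ × (Fin n → ℝ) => (Fin.cons p.1 p.2 : Fin (n + 1) → ℝ) :=
      hcons.measurable
    have hmap : ∀ h : (Fin (n + 1) → ℝ) → ℝ, AEStronglyMeasurable h (expPi (n + 1)) →
        ∫ y, h y ∂expPi (n + 1) = ∫ p, h (Fin.cons p.1 p.2) ∂expDist.prod (expPi n) := by
      intro h hh
      rw [expPi, ← hcons.map_eq] at *
      rw [integral_map hcm.aemeasurable hh, expPi]
    have hmp : MeasurePreserving (fun p : ℝ × (Fin n → ℝ) => (Fin.cons p.1 p.2 : Fin (n + 1) → ℝ))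
        (expDist.prod (expPi n)) (expPi (n + 1)) := hcons
    have hl : ∀ y : Fin n → ℝ, LipschitzWith L fun t : ℝ => f (Fin.cons t y) := fun y => by
      simpa [Function.comp_def] using hf.comp (lipschitzWith_cons_left y)
    have hr : ∀ t : ℝ, LipschitzWith L fun y : Fin n → ℝ => f (Fin.cons t y) := fun t => by
      simpa [Function.comp_def] using hf.comp (lipschitzWith_cons_right t)
    have hF := memLp_lipschitz_expPi hf
    have hG : MemLp (fun p : ℝ × (Fin n → ℝ) => f (Fin.cons p.1 p.2)) 2 (expDist.prod (expPi n)) :=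
      hF.comp_measurePreserving hmp
    have hlm : ∀ y, Integrable (fun t : ℝ => f (Fin.cons t y)) expDist := fun y =>
      (memLp_lipschitz_expDist (hl y)).integrable (by norm_num)
    have hrm : ∀ t, Integrable (fun y : Fin n → ℝ => f (Fin.cons t y)) (expPi n) := fun t =>
      (memLp_lipschitz_expPi (hr t)).integrable (by norm_num)
    have ha := memLp_lipschitz_expPi (lipschitzWith_integral hr hlm)
    have hb := memLp_lipschitz_expDist (lipschitzWith_integral hl hrm)
    have hdI : ∀ i, Integrable (fun y => y i * lineDeriv ℝ f y (Pi.single i 1) ^ 2)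
        (expPi (n + 1)) := fun i => integrable_mul_lineDeriv_sq_expPi hf i _
    have hd0 : Integrable (fun p : ℝ × (Fin n → ℝ) =>
        p.1 * deriv (fun u => f (Fin.cons u p.2)) p.1 ^ 2) (expDist.prod (expPi n)) := by
      have := hmp.integrable_comp_of_integrable (hdI 0)
      simpa [Function.comp_def, lineDeriv_single_zero] using this
    have hdS : Integrable (fun p : ℝ × (Fin n → ℝ) => ∑ i,
        p.2 i * lineDeriv ℝ (fun z => f (Fin.cons p.1 z)) p.2 (Pi.single i 1) ^ 2)
        (expDist.prod (expPi n)) := by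
      refine integrable_finsetSum _ fun i _ => ?_
      have := hmp.integrable_comp_of_integrable (hdI i.succ)
      simpa [Function.comp_def, lineDeriv_single_succ] using this
    rw [hmap _ hF.integrable_sq.aestronglyMeasurable, hmap _ hF.aestronglyMeasurable,
      hmap _ (integrable_finsetSum _ fun i _ => hdI i).aestronglyMeasurable]
    simp only [Fin.sum_univ_succ, Fin.cons_zero, Fin.cons_succ, lineDeriv_single_zero,
      lineDeriv_single_succ]
    rw [integral_add hd0 hdS]
    -- The variance in the first coordinate is handled by the one-variable inequality, that in the
    -- remaining ones by induction, fibre by fibre.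
    refine (integral_prod_variance_le hG ha hb).trans (add_le_add ?_ ?_)
    · rw [integral_prod_symm _ hG.integrable_sq, integral_prod_symm _ hd0,
        ← integral_sub hG.integrable_sq.integral_prod_right ha.integrable_sq]
      exact integral_mono (hG.integrable_sq.integral_prod_right.sub ha.integrable_sq)
        hd0.integral_prod_right fun y => poincare_expDist (hl y)
    · rw [integral_prod _ hG.integrable_sq, integral_prod _ hdS,
        ← integral_sub hG.integrable_sq.integral_prod_left hb.integrable_sq]
      exact integral_mono (hG.integrable_sq.integral_prod_left.sub hb.integrable_sq)
        hdS.integral_prod_left fun t => ih (hr t)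

/-! ### Sum and proportions of independent exponentials. -/

/-- The open positive orthant. -/
def orthant (n : ℕ) : Set (Fin n → ℝ) := {y | ∀ i, 0 < y i}

/-- The interior of the solid simplex, as a subset of `Fin n → ℝ`. -/
def openSimplex (n : ℕ) : Set (Fin n → ℝ) := {x | (∀ i, 0 < x i) ∧ ∑ i, x i < 1}

/-- The barycentric coordinates of a point of the solid simplex. -/
def bary {n : ℕ} (x : Fin n → ℝ) : Fin (n + 1) → ℝ := Fin.cons (1 - ∑ i, x i) x

theorem isOpen_orthant (n : ℕ) : IsOpen (orthant n) := by
  simp only [orthant, ofPred_forall]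
  exact isOpen_iInter_of_finite fun i => isOpen_lt continuous_const (continuous_apply i)

theorem isOpen_openSimplex (n : ℕ) : IsOpen (openSimplex n) := by
  have : openSimplex n = orthant n ∩ {x | ∑ i, x i < 1} := rfl
  rw [this]
  exact (isOpen_orthant n).inter (isOpen_lt (by fun_prop) continuous_const)

theorem measurable_finCons {n : ℕ} :
    Measurable fun p : ℝ × (Fin n → ℝ) => (Fin.cons p.1 p.2 : Fin (n + 1) → ℝ) :=
  (measurePreserving_cons n volume).measurable

theorem continuous_bary {n : ℕ} : Continuous (bary : (Fin n → ℝ) → Fin (n + 1) → ℝ) := by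
  refine continuous_pi fun i => ?_
  refine Fin.cases ?_ (fun i => ?_) i <;> simp only [bary, Fin.cons_zero, Fin.cons_succ] <;>
    fun_prop

theorem smul_bary_mem_orthant {n : ℕ} {s : ℝ} (hs : 0 < s) {x : Fin n → ℝ} :
    s • bary x ∈ orthant (n + 1) ↔ x ∈ openSimplex n := by
  simp only [orthant, openSimplex, bary, mem_ofPred_eq, Fin.forall_fin_succ, Pi.smul_apply,
    Fin.cons_zero, Fin.cons_succ, smul_eq_mul, mul_pos_iff_of_pos_left hs, sub_pos, and_comm]

theorem sum_bary {n : ℕ} (x : Fin n → ℝ) : ∑ i, bary x i = 1 := by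
  simp [bary, Fin.sum_univ_succ]

theorem lintegral_expPi (n : ℕ) {H : (Fin n → ℝ) → ENNReal} (hH : Measurable H) :
    ∫⁻ y, H y ∂expPi n =
      ∫⁻ y, (orthant n).indicator (fun y => ENNReal.ofReal (Real.exp (-∑ i, y i)) * H y) y := by
  induction n with
  | zero =>
    have h0 : expPi 0 = Measure.dirac 0 := Measure.pi_of_empty (fun _ : Fin 0 => expDist) 0
    have h1 : (volume : Measure (Fin 0 → ℝ)) = Measure.dirac 0 :=
      Measure.pi_of_empty (fun _ : Fin 0 => (volume : Measure ℝ)) 0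
    rw [h0, h1]
    simp [orthant]
  | succ n ih =>
    have hm := (isOpen_orthant (n + 1)).measurableSet
    have hcm := measurable_finCons (n := n)
    have h1 : MeasurePreserving (fun p : ℝ × (Fin n → ℝ) => (Fin.cons p.1 p.2 : Fin (n + 1) → ℝ))
        (expDist.prod (expPi n)) (expPi (n + 1)) := measurePreserving_cons n expDist
    have h2 : MeasurePreserving (fun p : ℝ × (Fin n → ℝ) => (Fin.cons p.1 p.2 : Fin (n + 1) → ℝ))
        (volume.prod volume) volume := measurePreserving_cons n volume
    have hI : Measurable ((orthant (n + 1)).indicator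
        (fun y => ENNReal.ofReal (Real.exp (-∑ i, y i)) * H y)) :=
      Measurable.indicator (by fun_prop) hm
    have hHc : Measurable fun p : ℝ × (Fin n → ℝ) => H (Fin.cons p.1 p.2) := hH.comp hcm
    have hIc : Measurable fun p : ℝ × (Fin n → ℝ) => (orthant (n + 1)).indicator
        (fun y => ENNReal.ofReal (Real.exp (-∑ i, y i)) * H y) (Fin.cons p.1 p.2) := hI.comp hcm
    rw [← h1.lintegral_comp hH, ← h2.lintegral_comp hI,
      lintegral_prod _ hHc.aemeasurable, lintegral_prod _ hIc.aemeasurable,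
      lintegral_expDist hHc.lintegral_prod_right',
      ← lintegral_indicator measurableSet_Ioi]
    refine lintegral_congr fun t => ?_
    have hHt : Measurable fun y : Fin n → ℝ => H (Fin.cons t y) :=
      hH.comp (hcm.comp measurable_prodMk_left)
    by_cases ht : 0 < t
    · rw [indicator_of_mem (mem_Ioi.2 ht), ih hHt, ← lintegral_const_mul]
      · refine lintegral_congr fun y => ?_
        by_cases hy : y ∈ orthant n
        · have hy' : (Fin.cons t y : Fin (n + 1) → ℝ) ∈ orthant (n + 1) := by
            intro i
            refine Fin.cases ?_ (fun i => ?_) i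
            · simpa
            · simpa using hy i
          rw [indicator_of_mem hy, indicator_of_mem hy', ← mul_assoc,
            ← ENNReal.ofReal_mul (Real.exp_nonneg _), ← Real.exp_add, Fin.sum_univ_succ]
          simp [add_comm]
        · have hy' : (Fin.cons t y : Fin (n + 1) → ℝ) ∉ orthant (n + 1) := fun h => hy fun i => by
            simpa using h i.succ
          rw [indicator_of_notMem hy, indicator_of_notMem hy', mul_zero]
      · exact Measurable.indicator (by fun_prop) (isOpen_orthant n).measurableSet
    · rw [indicator_of_notMem (by simpa using ht)]
      have : ∀ y : Fin n → ℝ, (Fin.cons t y : Fin (n + 1) → ℝ) ∉ orthant (n + 1) := fun y h =>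
        ht (by simpa using h 0)
      simp [this]

theorem lintegral_comp_smul_pi {n : ℕ} {s : ℝ} (hs : 0 < s) {Φ : (Fin n → ℝ) → ENNReal}
    (hΦ : Measurable Φ) :
    ∫⁻ y, Φ y = ENNReal.ofReal (s ^ n) * ∫⁻ x, Φ (s • x) := by
  have h := Measure.map_addHaar_smul (volume : Measure (Fin n → ℝ)) hs.ne'
  have h2 : ∫⁻ x, Φ (s • x) = ENNReal.ofReal |(s ^ n)⁻¹| * ∫⁻ y, Φ y := by
    rw [← lintegral_map hΦ (measurable_const_smul s), h, lintegral_smul_measure]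
    simp
  rw [h2, ← mul_assoc, ← ENNReal.ofReal_mul (by positivity), abs_of_pos (by positivity),
    mul_inv_cancel₀ (by positivity), ENNReal.ofReal_one, one_mul]

/-- Integration over independent exponential variables in terms of their sum and of their
proportions. -/
theorem lintegral_expPi_eq_polar (n : ℕ) {H : (Fin (n + 1) → ℝ) → ENNReal} (hH : Measurable H) :
    ∫⁻ y, H y ∂expPi (n + 1) =
      ∫⁻ s in Ioi 0, ENNReal.ofReal (Real.exp (-s) * s ^ n) *
        ∫⁻ x in openSimplex n, H (s • bary x) := by
  have hcm := measurable_finCons (n := n)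
  set Φ := (orthant (n + 1)).indicator
    (fun y => ENNReal.ofReal (Real.exp (-∑ i, y i)) * H y) with hΦ
  have hm := (isOpen_orthant (n + 1)).measurableSet
  have hI : Measurable Φ := Measurable.indicator (by fun_prop) hm
  have hIc : Measurable fun p : ℝ × (Fin n → ℝ) => Φ (Fin.cons p.1 p.2) := hI.comp hcm
  have h2 : MeasurePreserving (fun p : ℝ × (Fin n → ℝ) => (Fin.cons p.1 p.2 : Fin (n + 1) → ℝ))
    (volume.prod volume) volume := measurePreserving_cons n volume
  have hsh : Measurable fun p : ℝ × (Fin n → ℝ) =>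
      Φ (Fin.cons (p.1 - ∑ i, p.2 i) p.2) := by
    have : Measurable fun p : ℝ × (Fin n → ℝ) => (p.1 - ∑ i, p.2 i, p.2) := by fun_prop
    exact hI.comp (hcm.comp this)
  calc ∫⁻ y, H y ∂expPi (n + 1) = ∫⁻ y, Φ y := lintegral_expPi _ hH
    _ = ∫⁻ y : Fin n → ℝ, ∫⁻ t : ℝ, Φ (Fin.cons t y) := by
      rw [← h2.lintegral_comp hI, lintegral_prod_symm _ hIc.aemeasurable]
    -- The shear `t = s - ∑ yᵢ` makes the total `s` a coordinate. After exchanging the integrals,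
    -- the scaling `y = s x` contributes the Jacobian `sⁿ`.
    _ = ∫⁻ y : Fin n → ℝ, ∫⁻ s : ℝ, Φ (Fin.cons (s - ∑ i, y i) y) := by
      refine lintegral_congr fun y => ?_
      rw [lintegral_sub_right_eq_self (fun t => Φ (Fin.cons t y))]
    _ = ∫⁻ s : ℝ, ∫⁻ y : Fin n → ℝ, Φ (Fin.cons (s - ∑ i, y i) y) :=
      (lintegral_lintegral_swap (f := fun (s : ℝ) (y : Fin n → ℝ) =>
        Φ (Fin.cons (s - ∑ i, y i) y)) hsh.aemeasurable).symm
    _ = _ := by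
      rw [← lintegral_indicator measurableSet_Ioi]
      refine lintegral_congr fun s => ?_
      by_cases hs : 0 < s
      · have hsm : Measurable fun y : Fin n → ℝ => Φ (Fin.cons (s - ∑ i, y i) y) :=
          hsh.comp measurable_prodMk_left
        rw [indicator_of_mem (mem_Ioi.2 hs), lintegral_comp_smul_pi hs hsm]
        have hxs : ∀ x : Fin n → ℝ,
            (Fin.cons (s - ∑ i, (s • x) i) (s • x) : Fin (n + 1) → ℝ) = s • bary x := by
          intro x
          ext i
          refine Fin.cases ?_ (fun i => ?_) i
          · simp [bary, mul_sub, Finset.mul_sum]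
          · simp [bary]
        simp only [hxs]
        rw [mul_comm (Real.exp _), ENNReal.ofReal_mul (by positivity), mul_assoc,
          ← lintegral_indicator (isOpen_openSimplex n).measurableSet]
        congr 1
        rw [← lintegral_const_mul]
        · refine lintegral_congr fun x => ?_
          by_cases hx : x ∈ openSimplex n
          · rw [indicator_of_mem hx, hΦ, indicator_of_mem ((smul_bary_mem_orthant hs).2 hx)]
            simp [← Finset.mul_sum, sum_bary]
          · rw [indicator_of_notMem hx, hΦ,
              indicator_of_notMem (mt (smul_bary_mem_orthant hs).1 hx), mul_zero]
        · exact (hH.comp (continuous_bary.measurable.const_smul s)).indicator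
            (isOpen_openSimplex n).measurableSet
      · rw [indicator_of_notMem (by simpa using hs)]
        have : ∀ y : Fin n → ℝ, (Fin.cons (s - ∑ i, y i) y : Fin (n + 1) → ℝ) ∉ orthant (n + 1) := by
          intro y h
          have h0 : ∑ i, y i < s := by simpa using h 0
          have h1 : 0 ≤ ∑ i, y i := Finset.sum_nonneg fun i _ => by
            simpa using (h i.succ).le
          exact hs (h1.trans_lt h0)
        simp [hΦ, this]

/-- The (unnormalized) gamma distribution with shape `n + 1`. -/
noncomputable def gammaDist (n : ℕ) : Measure ℝ :=
  (volume.restrict (Ioi 0)).withDensity fun s => ENNReal.ofReal (Real.exp (-s) * s ^ n)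

theorem lintegral_gammaDist (n : ℕ) {h : ℝ → ENNReal} (hh : Measurable h) :
    ∫⁻ s, h s ∂gammaDist n = ∫⁻ s in Ioi 0, ENNReal.ofReal (Real.exp (-s) * s ^ n) * h s := by
  rw [gammaDist, lintegral_withDensity_eq_lintegral_mul _ (by fun_prop) hh]
  rfl

/-- Euler's integral for `Γ(n + k + 1)`; no division by the mass `n!` is needed, since Lebesgue
measure on the simplex is also left unnormalized. -/
theorem integral_pow_gammaDist (n k : ℕ) :
    ∫ s, s ^ k ∂gammaDist n = ((n + k).factorial : ℝ) := by
  rw [gammaDist, integral_withDensity_eq_integral_toReal_smul (by fun_prop) (by simp),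
    ← Real.Gamma_nat_eq_factorial, Real.Gamma_eq_integral (by positivity)]
  refine setIntegral_congr_fun measurableSet_Ioi fun s hs => ?_
  have : (0 : ℝ) < s := hs
  simp only [smul_eq_mul, add_sub_cancel_right, Real.rpow_natCast]
  rw [ENNReal.toReal_ofReal (by positivity), pow_add]
  ring

instance (n : ℕ) : SFinite (gammaDist n) := by
  unfold gammaDist; infer_instance

/-- The product measure on the right expresses the independence of the sum and the proportions. -/
theorem expPi_succ_eq_map (n : ℕ) :
    expPi (n + 1) = ((gammaDist n).prod (volume.restrict (openSimplex n))).map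
      fun p => p.1 • bary p.2 := by
  have hm : Measurable fun p : ℝ × (Fin n → ℝ) => p.1 • bary p.2 :=
    (continuous_fst.smul (continuous_bary.comp continuous_snd)).measurable
  refine Measure.ext_of_lintegral _ fun H hH => ?_
  have hHm : Measurable fun p : ℝ × (Fin n → ℝ) => H (p.1 • bary p.2) := hH.comp hm
  rw [lintegral_map hH hm, lintegral_prod _ hHm.aemeasurable,
    lintegral_gammaDist n hHm.lintegral_prod_right', lintegral_expPi_eq_polar n hH]

/-- The integral of a homogeneous function of independent exponential variables. -/
theorem integral_expPi_of_homogeneous (n k : ℕ) {G : (Fin (n + 1) → ℝ) → ℝ} {φ : (Fin n → ℝ) → ℝ}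
    (hG : AEStronglyMeasurable G (expPi (n + 1)))
    (hφ : ∀ᵐ x ∂volume.restrict (openSimplex n), ∀ s : ℝ, 0 < s → G (s • bary x) = s ^ k * φ x) :
    ∫ y, G y ∂expPi (n + 1) = (n + k).factorial * ∫ x in openSimplex n, φ x := by
  have hm : Measurable fun p : ℝ × (Fin n → ℝ) => p.1 • bary p.2 :=
    (continuous_fst.smul (continuous_bary.comp continuous_snd)).measurable
  have hpos : ∀ᵐ s ∂gammaDist n, 0 < s :=
    (withDensity_absolutelyContinuous _ _).ae_le (ae_restrict_mem measurableSet_Ioi)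
  rw [expPi_succ_eq_map] at hG ⊢
  rw [integral_map hm.aemeasurable hG, ← integral_pow_gammaDist, ← integral_prod_mul]
  refine integral_congr_ae ?_
  filter_upwards [Measure.quasiMeasurePreserving_fst.ae hpos,
    Measure.quasiMeasurePreserving_snd.ae hφ] with p h1 h2
  exact h2 p.1 h1

/-! ### The homogeneous extension and its energy. -/

/-- The extension of a function on the solid simplex to a function on the orthant which is
homogeneous of degree one. -/
noncomputable def coneExt {n : ℕ} (g : (Fin n → ℝ) → ℝ) (y : Fin (n + 1) → ℝ) : ℝ :=
  (∑ i, y i) * g ((∑ i, y i)⁻¹ • Fin.tail y)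

theorem sum_smul_bary {n : ℕ} (s : ℝ) (x : Fin n → ℝ) : ∑ i, (s • bary x) i = s := by
  simp [← Finset.mul_sum, sum_bary]

theorem tail_smul_bary {n : ℕ} (s : ℝ) (x : Fin n → ℝ) : Fin.tail (s • bary x) = s • x := by
  ext i
  simp [Fin.tail, bary]

theorem coneExt_smul_bary {n : ℕ} (g : (Fin n → ℝ) → ℝ) {s : ℝ} (hs : 0 < s) (x : Fin n → ℝ) :
    coneExt g (s • bary x) = s * g x := by
  rw [coneExt, sum_smul_bary, tail_smul_bary, inv_smul_smul₀ hs.ne']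

theorem norm_inv_sum_smul_tail_le {n : ℕ} {y : Fin (n + 1) → ℝ} (hy : y ∈ orthant (n + 1)) :
    ‖(∑ i, y i)⁻¹ • Fin.tail y‖ ≤ 1 := by
  have hS : 0 < ∑ i, y i := Finset.sum_pos (fun i _ => hy i) Finset.univ_nonempty
  refine (pi_norm_le_iff_of_nonneg zero_le_one).2 fun i => ?_
  rw [Pi.smul_apply, smul_eq_mul, Real.norm_eq_abs, Fin.tail,
    abs_of_pos (mul_pos (inv_pos.2 hS) (hy _)), inv_mul_le_one₀ hS]
  exact Finset.single_le_sum (fun j _ => (hy j).le) (Finset.mem_univ _)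

/-- Split the difference as `(S - T) g(u) + T (g(u) - g(v))`. On the orthant `‖u‖ ≤ 1`, so `|g u| ≤
|g 0| + L` and `T · dist u v ≤ |S - T| + dist y z`; in the sup norm `|S - T| ≤ (n + 1) dist y z`. -/
theorem lipschitzOnWith_coneExt {n : ℕ} {g : (Fin n → ℝ) → ℝ} {L : NNReal}
    (hg : LipschitzWith L g) :
    LipschitzOnWith ((n + 1) * (‖g 0‖₊ + L + L) + L) (coneExt g) (orthant (n + 1)) := by
  refine LipschitzOnWith.of_dist_le_mul fun y hy z hz => ?_
  set S := ∑ i, y i with hS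
  set T := ∑ i, z i with hT
  have hS0 : 0 < S := Finset.sum_pos (fun i _ => hy i) Finset.univ_nonempty
  have hT0 : 0 < T := Finset.sum_pos (fun i _ => hz i) Finset.univ_nonempty
  set u := S⁻¹ • Fin.tail y with hu
  set v := T⁻¹ • Fin.tail z with hv
  have hu1 : ‖u‖ ≤ 1 := norm_inv_sum_smul_tail_le hy
  have hST : |S - T| ≤ (n + 1) * dist y z := by
    rw [hS, hT, ← Finset.sum_sub_distrib]
    refine (Finset.abs_sum_le_sum_abs _ _).trans ?_
    refine (Finset.sum_le_card_nsmul _ _ (dist y z) fun i _ => ?_).trans_eq ?_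
    · exact dist_le_pi_dist y z i
    · simp
  have htail : ‖Fin.tail y - Fin.tail z‖ ≤ dist y z := by
    refine (pi_norm_le_iff_of_nonneg dist_nonneg).2 fun i => ?_
    exact dist_le_pi_dist y z i.succ
  have hgu : |g u| ≤ |g 0| + L := by
    have h := hg.dist_le_mul u 0
    rw [Real.dist_eq, dist_zero_right] at h
    have h2 := abs_sub_abs_le_abs_sub (g u) (g 0)
    have h3 := mul_le_mul_of_nonneg_left hu1 L.coe_nonneg
    linarith
  have hTuv : T * dist u v ≤ |S - T| + dist y z := by
    have h : T • (u - v) = (T - S) • u + (Fin.tail y - Fin.tail z) := by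
      have h1 : S • u = Fin.tail y := smul_inv_smul₀ hS0.ne' _
      have h2 : T • v = Fin.tail z := smul_inv_smul₀ hT0.ne' _
      rw [← h1, ← h2]
      module
    have h1 : T * dist u v = ‖T • (u - v)‖ := by
      rw [norm_smul, Real.norm_eq_abs, abs_of_pos hT0, dist_eq_norm]
    rw [h1, h]
    refine (norm_add_le _ _).trans (add_le_add ?_ htail)
    rw [norm_smul, Real.norm_eq_abs, abs_sub_comm]
    exact mul_le_of_le_one_right (abs_nonneg _) hu1
  have hguv : T * |g u - g v| ≤ L * (|S - T| + dist y z) := by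
    have := mul_le_mul_of_nonneg_left (hg.dist_le_mul u v) hT0.le
    rw [Real.dist_eq] at this
    nlinarith [L.coe_nonneg]
  have hsplit : coneExt g y - coneExt g z = (S - T) * g u + T * (g u - g v) := by
    change S * g u - T * g v = _
    ring
  rw [Real.dist_eq, hsplit]
  refine (abs_add_le _ _).trans ?_
  rw [abs_mul, abs_mul, abs_of_pos hT0]
  have h1 := mul_le_mul_of_nonneg_left hgu (abs_nonneg (S - T))
  have h2 := mul_le_mul_of_nonneg_right hST (by positivity : 0 ≤ |g 0| + L + L)
  push_cast
  rw [Real.norm_eq_abs]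
  nlinarith

/-- The derivative of a degree-one function has degree zero, so `s` drops out. The first term comes
from the growth of the sum, the second from the motion of the proportions. -/
theorem lineDeriv_coneExt {n : ℕ} {g : (Fin n → ℝ) → ℝ} {x : Fin n → ℝ}
    (hg : DifferentiableAt ℝ g x) {s : ℝ} (hs : 0 < s) (i : Fin (n + 1)) :
    lineDeriv ℝ (coneExt g) (s • bary x) (Pi.single i 1) =
      g x + fderiv ℝ g x (Fin.tail (Pi.single i 1 : Fin (n + 1) → ℝ) - x) := by
  set w := Fin.tail (Pi.single i 1 : Fin (n + 1) → ℝ)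
  have hcurve : ∀ t : ℝ, coneExt g (s • bary x + t • Pi.single i 1) =
      (s + t) * g ((s + t)⁻¹ • (s • x + t • w)) := by
    intro t
    have hsum : ∑ j, (s • bary x + t • Pi.single i 1 : Fin (n + 1) → ℝ) j = s + t := by
      change ∑ j, ((s • bary x) j + t * (Pi.single i 1 : Fin (n + 1) → ℝ) j) = s + t
      rw [Finset.sum_add_distrib, sum_smul_bary, ← Finset.mul_sum]
      simp
    rw [coneExt, hsum]
    congr 3
  have h1 : HasDerivAt (fun t : ℝ => s + t) 1 0 := (hasDerivAt_id 0).const_add s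
  have h2 : HasDerivAt (fun t : ℝ => (s + t)⁻¹) (-1 / s ^ 2) 0 := by
    simpa using h1.fun_inv (by simpa using hs.ne')
  have h3 : HasDerivAt (fun t : ℝ => s • x + t • w) w 0 := by
    simpa using ((hasDerivAt_id (0 : ℝ)).smul_const w).const_add (s • x)
  have h4 := h2.fun_smul h3
  have hx : (s + 0)⁻¹ • (s • x + (0 : ℝ) • w) = x := by
    simp [inv_smul_smul₀ hs.ne']
  have h5 : HasDerivAt (fun t : ℝ => g ((s + t)⁻¹ • (s • x + t • w)))
      (fderiv ℝ g x ((s + 0)⁻¹ • w + (-1 / s ^ 2) • (s • x + (0 : ℝ) • w))) 0 := by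
    have hg' : HasFDerivAt g (fderiv ℝ g x) ((s + 0)⁻¹ • (s • x + (0 : ℝ) • w)) := by
      rw [hx]; exact hg.hasFDerivAt
    exact hg'.comp_hasDerivAt (0 : ℝ) h4
  have h6 := h1.fun_mul h5
  rw [lineDeriv]
  simp only [hcurve]
  rw [h6.deriv, hx, one_mul]
  congr 1
  rw [← smul_eq_mul, ← map_smul]
  congr 1
  simp only [add_zero, zero_smul, smul_add, smul_smul]
  have e1 : s * s⁻¹ = 1 := mul_inv_cancel₀ hs.ne'
  have e2 : s * (-1 / s ^ 2 * s) = -1 := by field_simp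
  rw [e1, e2]
  module

/-- Read `bary x` as probability weights on the vertices. Their barycentre is `x`, so the values `D
(vertex - x)` are centred; the second moment of `c` plus a centred variable is `c²` plus its
variance. -/
theorem sum_bary_mul_sq {n : ℕ} (x : Fin n → ℝ) (D : (Fin n → ℝ) →L[ℝ] ℝ) (c s : ℝ) :
    ∑ i, (s • bary x) i * (c + D (Fin.tail (Pi.single i 1 : Fin (n + 1) → ℝ) - x)) ^ 2 =
      s * (c ^ 2 + ((∑ i, x i * D (Pi.single i 1) ^ 2) - (∑ i, x i * D (Pi.single i 1)) ^ 2)) := by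
  have hD : D x = ∑ i, x i * D (Pi.single i 1) := by
    have hx : x = ∑ i, x i • Pi.single i 1 := by
      ext j
      simp [Finset.sum_apply, Pi.single_apply]
    conv_lhs => rw [hx]
    simp only [map_sum, map_smul, smul_eq_mul]
  have h0 : Fin.tail (Pi.single 0 1 : Fin (n + 1) → ℝ) = 0 := by
    ext j; simp [Fin.tail]
  have hS : ∀ i : Fin n, Fin.tail (Pi.single i.succ 1 : Fin (n + 1) → ℝ) = Pi.single i 1 := by
    intro i; ext j; simp [Fin.tail, Pi.single_apply]
  rw [Fin.sum_univ_succ, h0]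
  simp only [hS, bary, Pi.smul_apply, Fin.cons_zero, Fin.cons_succ, smul_eq_mul, map_sub, map_zero]
  rw [hD]
  set m := ∑ i, x i * D (Pi.single i 1) with hm
  have : ∑ i, s * x i * (c + (D (Pi.single i 1) - m)) ^ 2 =
      s * ((c - m) ^ 2 * ∑ i, x i + 2 * (c - m) * ∑ i, x i * D (Pi.single i 1) +
        ∑ i, x i * D (Pi.single i 1) ^ 2) := by
    simp only [Finset.mul_sum, ← Finset.sum_add_distrib]
    exact Finset.sum_congr rfl fun i _ => by ring
  rw [this, ← hm]
  ring

/-! ### The inequality on the open simplex. -/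

theorem openSimplex_subset_closedBall (n : ℕ) : openSimplex n ⊆ Metric.closedBall 0 1 := by
  intro x hx
  rw [mem_closedBall_zero_iff, pi_norm_le_iff_of_nonneg zero_le_one]
  intro i
  rw [Real.norm_eq_abs, abs_of_pos (hx.1 i)]
  exact (Finset.single_le_sum (fun j _ => (hx.1 j).le) (Finset.mem_univ i)).trans hx.2.le

theorem volume_openSimplex_lt_top (n : ℕ) : volume (openSimplex n) < ⊤ :=
  (measure_mono (openSimplex_subset_closedBall n)).trans_lt measure_closedBall_lt_top

theorem integrableOn_openSimplex_of_bound {n : ℕ} {φ : (Fin n → ℝ) → ℝ} (hφ : Measurable φ)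
    (C : ℝ) (hC : ∀ x ∈ openSimplex n, |φ x| ≤ C) : IntegrableOn φ (openSimplex n) := by
  refine Measure.integrableOn_of_bounded (volume_openSimplex_lt_top n).ne
    hφ.aestronglyMeasurable (M := C) ?_
  exact (ae_restrict_mem (isOpen_openSimplex n).measurableSet).mono hC

/-- The Poincaré inequality on the simplex for a function which is Lipschitz on the whole space. -/
theorem poincare_openSimplex (n : ℕ) {g : (Fin n → ℝ) → ℝ} {L : NNReal} (hg : LipschitzWith L g)
    (h0 : ∫ x in openSimplex n, g x = 0) :
    ∫ x in openSimplex n, g x ^ 2 ≤ 1 / ((n : ℝ) + 1) * ∫ x in openSimplex n,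
      ((∑ i, x i * lineDeriv ℝ g x (Pi.single i 1) ^ 2) -
        (∑ i, x i * lineDeriv ℝ g x (Pi.single i 1)) ^ 2) := by
  -- `poincare_expPi` needs a globally Lipschitz function; `expPi` sees only the orthant, where `F`
  -- is the homogeneous extension.
  obtain ⟨F, hF, hFe⟩ := (lipschitzOnWith_coneExt hg).extend_real
  have hFs : ∀ x ∈ openSimplex n, ∀ s : ℝ, 0 < s → F (s • bary x) = s * g x := fun x hx s hs => by
    rw [← hFe ((smul_bary_mem_orthant hs).2 hx), coneExt_smul_bary g hs]
  have hmem : ∀ᵐ x ∂volume.restrict (openSimplex n), x ∈ openSimplex n :=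
    ae_restrict_mem (isOpen_openSimplex n).measurableSet
  have hFm := hF.continuous.measurable
  have hint1 : ∫ y, F y ∂expPi (n + 1) = (n + 1).factorial * ∫ x in openSimplex n, g x := by
    refine integral_expPi_of_homogeneous n 1 hFm.aestronglyMeasurable ?_
    filter_upwards [hmem] with x hx s hs
    rw [hFs x hx s hs, pow_one]
  have hint2 : ∫ y, F y ^ 2 ∂expPi (n + 1) =
      (n + 2).factorial * ∫ x in openSimplex n, g x ^ 2 := by
    refine integral_expPi_of_homogeneous n 2 (hFm.pow_const 2).aestronglyMeasurable ?_
    filter_upwards [hmem] with x hx s hs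
    rw [hFs x hx s hs, mul_pow]
  -- The energy density has degree one: `y i` has degree one and the derivatives degree zero.
  have hint3 : ∫ y, ∑ i, y i * lineDeriv ℝ F y (Pi.single i 1) ^ 2 ∂expPi (n + 1) =
      (n + 1).factorial * ∫ x in openSimplex n, (g x ^ 2 +
        ((∑ i, x i * lineDeriv ℝ g x (Pi.single i 1) ^ 2) -
          (∑ i, x i * lineDeriv ℝ g x (Pi.single i 1)) ^ 2)) := by
    refine integral_expPi_of_homogeneous n 1
      (integrable_finsetSum _ fun i _ =>
        integrable_mul_lineDeriv_sq_expPi hF i _).aestronglyMeasurable ?_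
    -- By Rademacher's theorem almost every `x` is a point of differentiability of `g`, and such an
    -- `x` serves its whole ray.
    filter_upwards [hmem, ae_restrict_of_ae hg.ae_differentiableAt] with x hx hd s hs
    have hy := (smul_bary_mem_orthant hs).2 hx
    have hev : F =ᶠ[𝓝 (s • bary x)] coneExt g :=
      (hFe.eventuallyEq_of_mem ((isOpen_orthant _).mem_nhds hy)).symm
    simp only [hev.lineDeriv_eq, lineDeriv_coneExt hd hs, hd.lineDeriv_eq_fderiv]
    rw [sum_bary_mul_sq, pow_one]
  have hmain := poincare_expPi (n + 1) hF
  have hdm : ∀ i, Measurable fun x => lineDeriv ℝ g x (Pi.single i 1) := fun i =>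
    measurable_lineDeriv hg.continuous
  have hgm := hg.continuous.measurable
  have hgb : ∀ x ∈ openSimplex n, |g x| ≤ |g 0| + L := by
    intro x hx
    have h := hg.dist_le_mul x 0
    rw [Real.dist_eq] at h
    have h2 := abs_sub_abs_le_abs_sub (g x) (g 0)
    have h3 := mul_le_mul_of_nonneg_left (openSimplex_subset_closedBall n hx) L.coe_nonneg
    linarith
  have hdb : ∀ i x, |lineDeriv ℝ g x (Pi.single i 1)| ≤ L := fun i x => by
    simpa [Pi.norm_single] using norm_lineDeriv_le_of_lipschitz ℝ hg (x₀ := x) (v := Pi.single i 1)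
  have hxb : ∀ x ∈ openSimplex n, ∀ i, |x i| ≤ 1 := fun x hx i => by
    have := openSimplex_subset_closedBall n hx
    rw [mem_closedBall_zero_iff, pi_norm_le_iff_of_nonneg zero_le_one] at this
    exact this i
  have hI1 : IntegrableOn (fun x => g x ^ 2) (openSimplex n) :=
    integrableOn_openSimplex_of_bound (by fun_prop) ((|g 0| + L) ^ 2) fun x hx => by
      rw [abs_pow]
      exact pow_le_pow_left₀ (abs_nonneg _) (hgb x hx) 2
  have hI2 : IntegrableOn (fun x => (∑ i, x i * lineDeriv ℝ g x (Pi.single i 1) ^ 2) -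
      (∑ i, x i * lineDeriv ℝ g x (Pi.single i 1)) ^ 2) (openSimplex n) := by
    refine integrableOn_openSimplex_of_bound (by fun_prop) (n * L ^ 2 + (n * L) ^ 2)
      fun x hx => ?_
    refine (abs_sub _ _).trans (add_le_add ?_ ?_)
    · refine (Finset.abs_sum_le_sum_abs _ _).trans
        ((Finset.sum_le_card_nsmul _ _ ((L : ℝ) ^ 2) fun i _ => ?_).trans_eq (by simp))
      rw [abs_mul, abs_pow, ← one_mul ((L : ℝ) ^ 2)]
      exact mul_le_mul (hxb x hx i) (pow_le_pow_left₀ (abs_nonneg _) (hdb i x) 2) (by positivity)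
        zero_le_one
    · rw [abs_pow]
      refine pow_le_pow_left₀ (abs_nonneg _) ((Finset.abs_sum_le_sum_abs _ _).trans
        ((Finset.sum_le_card_nsmul _ _ (L : ℝ) fun i _ => ?_).trans_eq (by simp))) 2
      rw [abs_mul, ← one_mul (L : ℝ)]
      exact mul_le_mul (hxb x hx i) (hdb i x) (by positivity) zero_le_one
  rw [hint1, hint2, hint3, h0, integral_add hI1 hI2, Nat.factorial_succ (n + 1)] at hmain
  set A := ∫ x in openSimplex n, g x ^ 2
  set B := ∫ x in openSimplex n, ((∑ i, x i * lineDeriv ℝ g x (Pi.single i 1) ^ 2) -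
      (∑ i, x i * lineDeriv ℝ g x (Pi.single i 1)) ^ 2)
  have hfac : (0 : ℝ) < (n + 1).factorial := by exact_mod_cast Nat.factorial_pos _
  push_cast at hmain
  -- Since `(n+2)! = (n+2) (n+1)!`, cancelling `(n+1)!` leaves `(n + 2) A ≤ A + B`.
  have h7 : ((n + 1).factorial : ℝ) * (((n : ℝ) + 1 + 1) * A) ≤ (n + 1).factorial * (A + B) := by
    linarith
  have h8 := le_of_mul_le_mul_left h7 hfac
  rw [div_mul_eq_mul_div, one_mul, le_div_iff₀ (by positivity)]
  linarith

/-- The Poincaré inequality on the simplex. -/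
theorem poincare_openSimplex_of_lipschitzOn (n : ℕ) {g : (Fin n → ℝ) → ℝ} {L : NNReal}
    (hg : LipschitzOnWith L g (openSimplex n)) (h0 : ∫ x in openSimplex n, g x = 0) :
    ∫ x in openSimplex n, g x ^ 2 ≤ 1 / ((n : ℝ) + 1) * ∫ x in openSimplex n,
      ((∑ i, x i * lineDeriv ℝ g x (Pi.single i 1) ^ 2) -
        (∑ i, x i * lineDeriv ℝ g x (Pi.single i 1)) ^ 2) := by
  obtain ⟨h, hL, he⟩ := hg.extend_real
  have hm := (isOpen_openSimplex n).measurableSet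
  have hd : ∀ x ∈ openSimplex n, ∀ v, lineDeriv ℝ g x v = lineDeriv ℝ h x v := fun x hx v =>
    (he.eventuallyEq_of_mem ((isOpen_openSimplex n).mem_nhds hx)).lineDeriv_eq
  rw [setIntegral_congr_fun hm he] at h0
  have h1 : ∫ x in openSimplex n, g x ^ 2 = ∫ x in openSimplex n, h x ^ 2 :=
    setIntegral_congr_fun hm fun x hx => congrArg (· ^ 2) (he hx)
  have h2 : ∫ x in openSimplex n, ((∑ i, x i * lineDeriv ℝ g x (Pi.single i 1) ^ 2) -
        (∑ i, x i * lineDeriv ℝ g x (Pi.single i 1)) ^ 2) =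
      ∫ x in openSimplex n, ((∑ i, x i * lineDeriv ℝ h x (Pi.single i 1) ^ 2) -
        (∑ i, x i * lineDeriv ℝ h x (Pi.single i 1)) ^ 2) :=
    setIntegral_congr_fun hm fun x hx => by simp only [hd x hx]
  rw [h1, h2]
  exact poincare_openSimplex n hL h0

/-! ### Transfer to the solid simplex in Euclidean space. -/

theorem toLp_add_smul_single {n : ℕ} (x : Fin n → ℝ) (t : ℝ) (i : Fin n) :
    WithLp.toLp 2 (x + t • Pi.single i 1) =
      WithLp.toLp 2 x + t • EuclideanSpace.single i (1 : ℝ) := by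
  ext j
  simp [Pi.single_apply]

theorem lineDeriv_comp_toLp {n : ℕ} (f : EuclideanSpace ℝ (Fin n) → ℝ) (x : Fin n → ℝ)
    (i : Fin n) :
    lineDeriv ℝ (fun y : Fin n → ℝ => f (WithLp.toLp 2 y)) x (Pi.single i 1) =
      partialDeriv i f (WithLp.toLp 2 x) := by
  simp only [partialDeriv, lineDeriv, toLp_add_smul_single]

theorem ofLp_preimage_openSimplex_subset (n : ℕ) :
    WithLp.ofLp ⁻¹' openSimplex n ⊆ solidSimplex n := by
  intro x hx
  let z : Fin (n + 1) → EuclideanSpace ℝ (Fin n) :=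
    Fin.cons 0 fun i => EuclideanSpace.single i (1 : ℝ)
  have hz : ∀ i ∈ Finset.univ, z i ∈ solidSimplex n := by
    intro i _
    refine subset_convexHull ℝ _ ?_
    refine Fin.cases ?_ (fun i => ?_) i
    · simp [z]
    · exact mem_insert_of_mem _ ⟨i, by simp [z]⟩
  have h0 : ∀ i ∈ Finset.univ, 0 ≤ bary x.ofLp i := by
    intro i _
    have := (smul_bary_mem_orthant one_pos).2 hx i
    rw [one_smul] at this
    exact this.le
  have h := (convex_convexHull ℝ _).sum_mem h0 (sum_bary x.ofLp) hz
  convert! h using 1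
  rw [Fin.sum_univ_succ]
  ext j
  simp [z, bary, Pi.single_apply]

theorem solidSimplex_subset (n : ℕ) :
    solidSimplex n ⊆ {x | (∀ i, 0 ≤ x i) ∧ ∑ i, x i ≤ 1} := by
  refine convexHull_min ?_ ?_
  · rintro x (rfl | ⟨i, rfl⟩)
    · simp
    · refine ⟨fun j => ?_, ?_⟩
      · rw [PiLp.single_apply]; split_ifs <;> simp
      · simp [PiLp.single_apply]
  · intro x hx y hy a b ha hb hab
    refine ⟨fun i => ?_, ?_⟩
    · exact add_nonneg (mul_nonneg ha (hx.1 i)) (mul_nonneg hb (hy.1 i))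
    · change ∑ i, (a * x i + b * y i) ≤ 1
      rw [Finset.sum_add_distrib, ← Finset.mul_sum, ← Finset.mul_sum]
      nlinarith [hx.2, hy.2]

/-- An interior point can be moved slightly in any direction without leaving the simplex. Moving
along `-eᵢ` forces `xᵢ > 0`; moving along `x` itself multiplies the coordinate sum by `1 + t` and
forces it below `1`. -/
theorem interior_solidSimplex_subset (n : ℕ) :
    interior (solidSimplex n) ⊆ WithLp.ofLp ⁻¹' openSimplex n := by
  intro x hx
  have key : ∀ v : EuclideanSpace ℝ (Fin n), ∃ t : ℝ, 0 < t ∧ x + t • v ∈ solidSimplex n := by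
    intro v
    have hc : Tendsto (fun t : ℝ => x + t • v) (𝓝[>] 0) (𝓝 x) := by
      have : Continuous fun t : ℝ => x + t • v := by fun_prop
      simpa using (this.tendsto 0).mono_left nhdsWithin_le_nhds
    have h := (hc.eventually (mem_interior_iff_mem_nhds.1 hx)).and self_mem_nhdsWithin
    obtain ⟨t, h1, h2⟩ := h.exists
    exact ⟨t, h2, h1⟩
  have hx' := solidSimplex_subset n (interior_subset hx)
  refine ⟨fun i => ?_, ?_⟩
  · obtain ⟨t, ht, hmem⟩ := key (-EuclideanSpace.single i 1)
    have := (solidSimplex_subset n hmem).1 i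
    simp at this
    linarith
  · obtain ⟨t, ht, hmem⟩ := key x
    have h1 := (solidSimplex_subset n hmem).2
    have h2 : ∑ i, (x + t • x) i = (1 + t) * ∑ i, x i := by
      simp only [PiLp.add_apply, PiLp.smul_apply, smul_eq_mul, Finset.sum_add_distrib,
        ← Finset.mul_sum]
      ring
    rw [h2] at h1
    by_contra! hge
    change 1 ≤ ∑ i, x i at hge
    nlinarith

/-- The two sets differ only within the frontier of a convex set, which is null. -/
theorem setIntegral_solidSimplex (n : ℕ) (φ : EuclideanSpace ℝ (Fin n) → ℝ) :
    ∫ x in solidSimplex n, φ x = ∫ x in openSimplex n, φ (WithLp.toLp 2 x) := by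
  have hae : (solidSimplex n : Set _) =ᵐ[volume] WithLp.ofLp ⁻¹' openSimplex n := by
    refine Filter.EventuallyLE.antisymm ?_ (ofLp_preimage_openSimplex_subset n).eventuallyLE
    have hconv : Convex ℝ (solidSimplex n) := convex_convexHull ℝ _
    refine ae_le_set.2 (measure_mono_null ?_ (hconv.addHaar_frontier volume))
    exact fun x hx => ⟨subset_closure hx.1, fun h => hx.2 (interior_solidSimplex_subset n h)⟩
  rw [setIntegral_congr_set hae]
  have h := (PiLp.volume_preserving_toLp (Fin n)).setIntegral_preimage_emb
    (MeasurableEquiv.toLp 2 (Fin n → ℝ)).measurableEmbedding φ (WithLp.ofLp ⁻¹' openSimplex n)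
  rw [← h]
  rfl

/-- The Poincaré inequality on the solid simplex in Euclidean space. -/
theorem poincare_solidSimplex (n : ℕ) {f : EuclideanSpace ℝ (Fin n) → ℝ} {L : NNReal}
    (hf : LipschitzOnWith L f (solidSimplex n)) (h0 : ∫ x in solidSimplex n, f x = 0) :
    ∫ x in solidSimplex n, f x ^ 2 ≤ 1 / ((n : ℝ) + 1) * ∫ x in solidSimplex n,
      ((∑ i, x i * |partialDeriv i f x| ^ 2) - (∑ i, x i * partialDeriv i f x) ^ 2) := by
  rw [setIntegral_solidSimplex] at h0 ⊢
  rw [setIntegral_solidSimplex]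
  have hg : LipschitzOnWith _ (fun x : Fin n → ℝ => f (WithLp.toLp 2 x)) (openSimplex n) :=
    hf.comp (PiLp.lipschitzWith_toLp 2 (fun _ : Fin n => ℝ)).lipschitzOnWith fun x hx =>
      ofLp_preimage_openSimplex_subset n hx
  simpa only [lineDeriv_comp_toLp, sq_abs] using poincare_openSimplex_of_lipschitzOn n hg h0

/-! ### Transfer to the regular simplex. -/

/-- The affine parametrization of the hyperplane containing the regular simplex. -/
noncomputable def baryEuclidean {n : ℕ} (x : Fin n → ℝ) : EuclideanSpace ℝ (Fin (n + 1)) :=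
  WithLp.toLp 2 (bary x)

theorem lipschitzWith_bary (n : ℕ) :
    LipschitzWith (n + 1) (bary : (Fin n → ℝ) → Fin (n + 1) → ℝ) := by
  refine LipschitzWith.of_dist_le_mul fun x y => ?_
  have hd : 0 ≤ dist x y := dist_nonneg
  have hn : (0 : ℝ) ≤ n := n.cast_nonneg
  push_cast
  refine (dist_pi_le_iff (by positivity)).2 fun i => ?_
  refine Fin.cases ?_ (fun i => ?_) i
  · have : |∑ i, (x i - y i)| ≤ n * dist x y := by
      refine (Finset.abs_sum_le_sum_abs _ _).trans
        ((Finset.sum_le_card_nsmul _ _ (dist x y) fun i _ => ?_).trans_eq (by simp))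
      exact dist_le_pi_dist x y i
    rw [Finset.sum_sub_distrib, abs_sub_comm] at this
    simp only [bary, Fin.cons_zero, Real.dist_eq, sub_sub_sub_cancel_left]
    linarith
  · have := dist_le_pi_dist x y i
    simp only [bary, Fin.cons_succ]
    nlinarith

theorem exists_lipschitzWith_baryEuclidean (n : ℕ) :
    ∃ C, LipschitzWith C (baryEuclidean : (Fin n → ℝ) → _) :=
  ⟨_, (PiLp.lipschitzWith_toLp 2 (fun _ : Fin (n + 1) => ℝ)).comp (lipschitzWith_bary n)⟩

theorem measurableEmbedding_baryEuclidean (n : ℕ) :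
    MeasurableEmbedding (baryEuclidean : (Fin n → ℝ) → _) := by
  obtain ⟨C, hC⟩ := exists_lipschitzWith_baryEuclidean n
  refine hC.continuous.measurableEmbedding fun x y h => ?_
  have h1 : bary x = bary y := WithLp.toLp_injective 2 h
  exact (Fin.cons_injective2 h1).2

theorem baryEuclidean_add {n : ℕ} (v x : Fin n → ℝ) :
    baryEuclidean (v + x) = (baryEuclidean v - baryEuclidean 0) + baryEuclidean x := by
  ext i
  refine Fin.cases ?_ (fun i => ?_) i
  · simp [baryEuclidean, bary, Finset.sum_add_distrib]; ring
  · simp [baryEuclidean, bary]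

/-- The Hausdorff measure on the hyperplane containing the regular simplex is a multiple of
the Lebesgue measure in the affine parametrization. -/
theorem exists_comap_baryEuclidean_eq_smul (n : ℕ) :
    ∃ c : NNReal, (μHE[n] : Measure (EuclideanSpace ℝ (Fin (n + 1)))).comap baryEuclidean =
      c • (volume : Measure (Fin n → ℝ)) := by
  have he := measurableEmbedding_baryEuclidean n
  set ν := (μHE[n] : Measure (EuclideanSpace ℝ (Fin (n + 1)))).comap
    (baryEuclidean : (Fin n → ℝ) → _) with hν
  have happ : ∀ s, ν s = μHE[n] (baryEuclidean '' s) := fun s => he.comap_apply _ s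
  obtain ⟨C, hC⟩ := exists_lipschitzWith_baryEuclidean n
  have hinv : ν.IsAddLeftInvariant := by
    refine ⟨fun v => Measure.ext fun s hs => ?_⟩
    rw [Measure.map_apply (measurable_const_add v) hs, happ, happ,
      ← measure_preimage_add μHE[n] (baryEuclidean v - baryEuclidean 0) (baryEuclidean '' s)]
    congr 1
    ext p
    constructor
    · rintro ⟨x, hx, rfl⟩
      exact ⟨v + x, hx, baryEuclidean_add v x⟩
    · rintro ⟨x, hx, h⟩
      refine ⟨x - v, by simpa using hx, ?_⟩
      have := baryEuclidean_add v (x - v)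
      rw [add_sub_cancel, h] at this
      exact (add_left_cancel this).symm
  have hfin : IsFiniteMeasureOnCompacts ν := by
    refine ⟨fun K hK => ?_⟩
    -- Lipschitz maps enlarge Hausdorff measure by a bounded factor, and for the sup metric on `Fin
    -- n → ℝ` it is Lebesgue measure.
    rw [happ, Measure.euclideanHausdorffMeasure_def, Measure.smul_apply]
    refine ENNReal.mul_lt_top ENNReal.coe_lt_top
      ((hC.hausdorffMeasure_image_le n.cast_nonneg K).trans_lt ?_)
    have hvol : (μH[(n : ℝ)] : Measure (Fin n → ℝ)) = volume := by
      simpa using hausdorffMeasure_pi_real (ι := Fin n)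
    rw [hvol]
    exact ENNReal.mul_lt_top (by simp) hK.measure_lt_top
  exact ⟨_, Measure.isAddLeftInvariant_eq_smul ν volume⟩

theorem image_baryEuclidean (n : ℕ) : baryEuclidean '' openSimplex n = regularSimplex n := by
  ext p
  constructor
  · rintro ⟨x, hx, rfl⟩
    refine ⟨fun i => ?_, sum_bary x⟩
    have := (smul_bary_mem_orthant one_pos).2 hx i
    rwa [one_smul] at this
  · rintro ⟨h1, h2⟩
    have hs : ∑ i, p i = p 0 + ∑ i, Fin.tail p.ofLp i := Fin.sum_univ_succ _
    refine ⟨Fin.tail p.ofLp, ⟨fun i => h1 i.succ, ?_⟩, ?_⟩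
    · linarith [h1 0]
    · ext i
      refine Fin.cases ?_ (fun i => ?_) i
      · simp only [baryEuclidean, bary, Fin.cons_zero]
        linarith
      · simp [baryEuclidean, bary, Fin.tail]

/-- The Poincaré inequality is unaffected by rescaling the measure, so the value of `c` is never
computed, nor is `c = 0` excluded. -/
theorem exists_setIntegral_regularSimplex (n : ℕ) :
    ∃ c : NNReal, ∀ φ : EuclideanSpace ℝ (Fin (n + 1)) → ℝ,
      ∫ p in regularSimplex n, φ p ∂μHE[n] = c * ∫ x in openSimplex n, φ (baryEuclidean x) := by
  obtain ⟨c, hc⟩ := exists_comap_baryEuclidean_eq_smul n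
  refine ⟨c, fun φ => ?_⟩
  have he := measurableEmbedding_baryEuclidean n
  have h1 := he.setIntegral_map (μ := (μHE[n]).comap baryEuclidean) φ (regularSimplex n)
  have hpre : baryEuclidean ⁻¹' regularSimplex n = openSimplex n := by
    rw [← image_baryEuclidean, preimage_image_eq _ he.injective]
  have hsub : regularSimplex n ⊆ range (baryEuclidean : (Fin n → ℝ) → _) := by
    rw [← image_baryEuclidean]; exact image_subset_range _ _
  rw [he.map_comap, Measure.restrict_restrict_of_subset hsub, hpre, hc, Measure.restrict_smul] at h1
  rw [h1, integral_smul_nnreal_measure]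
  rfl

theorem tangentDeriv_baryEuclidean {n : ℕ} (f : EuclideanSpace ℝ (Fin (n + 1)) → ℝ)
    (x : Fin n → ℝ) (i j : Fin (n + 1)) :
    tangentDeriv i j f (baryEuclidean x) = lineDeriv ℝ (fun y => f (baryEuclidean y)) x
      (Fin.tail (Pi.single i 1 : Fin (n + 1) → ℝ) - Fin.tail (Pi.single j 1 : Fin (n + 1) → ℝ)) := by
  have h : ∀ t : ℝ, baryEuclidean (x + t • (Fin.tail (Pi.single i 1 : Fin (n + 1) → ℝ) -
      Fin.tail (Pi.single j 1 : Fin (n + 1) → ℝ))) = baryEuclidean x +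
        t • (EuclideanSpace.single i (1 : ℝ) - EuclideanSpace.single j (1 : ℝ)) := by
    have hs : ∀ i : Fin (n + 1), ∑ k, Fin.tail (Pi.single i 1 : Fin (n + 1) → ℝ) k =
        1 - (Pi.single i 1 : Fin (n + 1) → ℝ) 0 := fun i => by
      have h1 : ∑ k, (Pi.single i 1 : Fin (n + 1) → ℝ) k = 1 := by simp
      rw [Fin.sum_univ_succ] at h1
      exact eq_sub_of_add_eq' h1
    intro t
    ext k
    refine Fin.cases ?_ (fun k => ?_) k
    · simp only [baryEuclidean, bary, Fin.cons_zero, Pi.add_apply, Pi.smul_apply, Pi.sub_apply,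
        smul_eq_mul, Finset.sum_add_distrib, ← Finset.mul_sum, Finset.sum_sub_distrib, hs,
        PiLp.add_apply, PiLp.smul_apply, PiLp.sub_apply, PiLp.single_apply, Pi.single_apply]
      ring
    · simp [baryEuclidean, bary, Fin.tail, Pi.single_apply]
  simp only [tangentDeriv, lineDeriv, h]

/-- Lagrange's identity for a weighted sum of squared differences. -/
theorem sum_Ioi_mul_sub_sq {n : ℕ} (p δ : Fin n → ℝ) :
    ∑ i, ∑ j ∈ Finset.Ioi i, p i * p j * (δ i - δ j) ^ 2 =
      (∑ i, p i) * (∑ i, p i * δ i ^ 2) - (∑ i, p i * δ i) ^ 2 := by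
  have h1 := Finset.sum_sum_Ioi_add_eq_sum_sum_off_diag
    fun i j : Fin n => p i * p j * (δ i - δ j) ^ 2
  -- The diagonal terms vanish, so they may be restored to get a full double sum, twice the sum over
  -- `i < j`.
  have h2 : ∀ i, ∑ j ∈ ({i}ᶜ : Finset (Fin n)), p j * p i * (δ j - δ i) ^ 2 =
      ∑ j, p j * p i * (δ j - δ i) ^ 2 := fun i => by
    rw [← Finset.sum_add_sum_compl {i} fun j => p j * p i * (δ j - δ i) ^ 2]
    simp
  have h3 : ∀ i j, p j * p i * (δ j - δ i) ^ 2 + p i * p j * (δ i - δ j) ^ 2 =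
      2 * (p i * p j * (δ i - δ j) ^ 2) := fun i j => by ring
  simp only [h2, h3, ← Finset.mul_sum] at h1
  have h4 : ∑ i, ∑ j, p j * p i * (δ j - δ i) ^ 2 =
      2 * ((∑ i, p i) * (∑ i, p i * δ i ^ 2) - (∑ i, p i * δ i) ^ 2) := by
    have e : ∀ i j, p j * p i * (δ j - δ i) ^ 2 =
        p i * (p j * δ j ^ 2) + (p i * δ i ^ 2) * p j - 2 * ((p i * δ i) * (p j * δ j)) :=
      fun i j => by ring
    simp only [e, Finset.sum_sub_distrib, Finset.sum_add_distrib, ← Finset.mul_sum,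
      ← Finset.sum_mul]
    ring
  linarith

/-- Both sides are the variance of `D` over the vertices with weights `bary x`; this is the
equivalence of the two forms of the inequality. -/
theorem sum_Ioi_bary_mul_sq {n : ℕ} (x : Fin n → ℝ) (D : (Fin n → ℝ) →L[ℝ] ℝ) :
    ∑ i, ∑ j ∈ Finset.Ioi i, bary x i * bary x j *
      D (Fin.tail (Pi.single i 1 : Fin (n + 1) → ℝ) - Fin.tail (Pi.single j 1 : Fin (n + 1) → ℝ)) ^ 2 =
    (∑ i, x i * D (Pi.single i 1) ^ 2) - (∑ i, x i * D (Pi.single i 1)) ^ 2 := by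
  have h0 : Fin.tail (Pi.single 0 1 : Fin (n + 1) → ℝ) = 0 := by
    ext j; simp [Fin.tail]
  have hS : ∀ i : Fin n, Fin.tail (Pi.single i.succ 1 : Fin (n + 1) → ℝ) = Pi.single i 1 := by
    intro i; ext j; simp [Fin.tail, Pi.single_apply]
  simp only [map_sub]
  rw [sum_Ioi_mul_sub_sq (bary x) fun i => D (Fin.tail (Pi.single i 1 : Fin (n + 1) → ℝ)),
    sum_bary, one_mul, Fin.sum_univ_succ, Fin.sum_univ_succ]
  simp [h0, hS, bary]

/-- The Poincaré inequality on the regular simplex. -/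
theorem poincare_regularSimplex (n : ℕ) {f : EuclideanSpace ℝ (Fin (n + 1)) → ℝ} {L : NNReal}
    (hf : LipschitzOnWith L f (regularSimplex n))
    (h0 : ∫ x in regularSimplex n, f x ∂μHE[n] = 0) :
    ∫ x in regularSimplex n, f x ^ 2 ∂μHE[n] ≤
      1 / ((n : ℝ) + 1) * ∫ x in regularSimplex n, (∑ i : Fin (n + 1), ∑ j ∈ Finset.Ioi i,
        x i * x j * |tangentDeriv i j f x| ^ 2) ∂μHE[n] := by
  obtain ⟨c, hc⟩ := exists_setIntegral_regularSimplex n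
  rw [hc] at h0 ⊢
  rw [hc]
  rcases eq_or_ne c 0 with rfl | hc0
  · simp
  have hc1 : (c : ℝ) ≠ 0 := by exact_mod_cast hc0
  have h1 := (mul_eq_zero.1 h0).resolve_left hc1
  obtain ⟨C, hC⟩ := exists_lipschitzWith_baryEuclidean n
  have hm := (isOpen_openSimplex n).measurableSet
  have hg : LipschitzOnWith _ (fun x : Fin n → ℝ => f (baryEuclidean x)) (openSimplex n) :=
    hf.comp hC.lipschitzOnWith fun x hx => image_baryEuclidean n ▸ mem_image_of_mem _ hx
  have key := poincare_openSimplex_of_lipschitzOn n hg h1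
  have hgrad : ∫ x in openSimplex n, (∑ i : Fin (n + 1), ∑ j ∈ Finset.Ioi i,
        baryEuclidean x i * baryEuclidean x j * |tangentDeriv i j f (baryEuclidean x)| ^ 2) =
      ∫ x in openSimplex n,
        ((∑ i, x i * lineDeriv ℝ (fun x => f (baryEuclidean x)) x (Pi.single i 1) ^ 2) -
        (∑ i, x i * lineDeriv ℝ (fun x => f (baryEuclidean x)) x (Pi.single i 1)) ^ 2) := by
    refine setIntegral_congr_ae hm ?_
    -- Differentiability makes the line derivative linear in its direction, which the algebraic
    -- identity needs; it holds almost everywhere.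
    filter_upwards [hg.ae_differentiableWithinAt_of_mem] with x hd hx
    have hdx := (hd hx).differentiableAt ((isOpen_openSimplex n).mem_nhds hx)
    simp only [tangentDeriv_baryEuclidean, sq_abs, hdx.lineDeriv_eq_fderiv]
    exact sum_Ioi_bary_mul_sq x _
  rw [hgrad, mul_left_comm]
  exact mul_le_mul_of_nonneg_left key c.coe_nonneg

end SimplexPoincare

theorem corollary4p4 (n : ℕ) (hn : 1 ≤ n) :
    (∀ f : EuclideanSpace ℝ (Fin n) → ℝ,
      (∃ L, LipschitzOnWith L f (solidSimplex n)) →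
      ∫ x in solidSimplex n, f x = 0 →
      ∫ x in solidSimplex n, f x ^ 2 ≤
        1 / ((n : ℝ) + 1) * ∫ x in solidSimplex n,
          ((∑ i, x i * |partialDeriv i f x| ^ 2) - (∑ i, x i * partialDeriv i f x) ^ 2)) ∧
    (∀ f : EuclideanSpace ℝ (Fin (n + 1)) → ℝ,
      (∃ L, LipschitzOnWith L f (regularSimplex n)) →
      ∫ x in regularSimplex n, f x ∂μHE[n] = 0 →
      ∫ x in regularSimplex n, f x ^ 2 ∂μHE[n] ≤
        1 / ((n : ℝ) + 1) * ∫ x in regularSimplex n,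
          (∑ i : Fin (n + 1), ∑ j ∈ Finset.Ioi i,
            x i * x j * |tangentDeriv i j f x| ^ 2) ∂μHE[n]) := by
  exact ⟨fun _ ⟨_, hf⟩ h0 => SimplexPoincare.poincare_solidSimplex n hf h0,
    fun _ ⟨_, hf⟩ h0 => SimplexPoincare.poincare_regularSimplex n hf h0⟩
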